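/- **Conventions.** All actions are by isometries. For $\delta>0$, a (nonempty) geodesic metric space $(S,d)$ is $\delta$-hyperbolic if each side of every geodesic triangle lies in the closed $\delta$-neighbourhood of the union of the other two sides. For an isometry $g$, $\tau(g)=\lim_{n}\frac1n d(x,g^nx)$ (independent of $x\in S$), and $g$ is loxodromic if $\tau(g)>0$. An action of a group $\Gamma$ on $S$ is acylindrical with parameters $R(\cdot),N(\cdot)$ if for every $r>0$ and all $x,x'\in S$ with $d(x,x')\ge R(r)$ there are at most $N(r)$ elements $g\in\Gamma$ with $d(x,gx)\le r$ and $d(x',gx')\le r$. An element $a\in\Gamma$ is achiral if $a^m$ is conjugate to $a^{-m}$ for some $m\ge1$, and chiral otherwise. For a symmetric subset $A\subset\Gamma$ (i.e. $A^{-1}=A$) and $g\in\langle A\rangle$, let $\nu_A(g)$ be the least number of elements of $A$ whose product is $g$, and $\overline{\nu_A}(g)=\lim_n\nu_A(g^n)/n$. For $g\in\Gamma$ put $\overline{\nu_A}(g)=\overline{\nu_A}(g^m)/m$ if $g^m\in\langle A\rangle$ for some $m\ge1$, and $\overline{\nu_A}(g)=\infty$ if there is no such $m$. For a rectifiable path $w$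 in $S$ of length $|w|$, a real $W$ with $0<W<|w|$ and $x,y\in S$, let $$c_{w,W}(x,y)=d(x,y)-\inf_\alpha\bigl(|\alpha|-W|\alpha|_w\bigr),$$ where $\alpha$ runs over the rectifiable paths from $x$ to $y$ and $|\alpha|_w$ is the maximal number of non-overlapping subpaths of $\alpha$ of the form $\gamma w$ with $\gamma\in\Gamma$ (paths being parametrized by arc length; consecutive copies may share an endpoint). For $x_0\in S$ and $a\in\Gamma$ let $$h_{w,W,x_0}(a)=c_{w,W}(x_0,ax_0)-c_{w^{-1},W}(x_0,ax_0),\qquad \overline{h}(a)=\lim_n h(a^n)/n .$$ **Theorem.** Let $\delta>0$. (0) There are constants $T,K>0$ such that for every action of a group $\Gamma$ on a $\delta$-hyperbolic space $S$, every $g\in\Gamma$ with $\tau(g)\ge T$, every $x\in S$ with $d(x,gx)-\inf_{z\in S}d(z,gz)\le\delta$ and every integer $i\ge0$, $$i\,\tau(g)\le d(x,g^ix)\le i\,\tau(g)+K. \qquad(*)$$ Fix any $T,K>0$ with property $(*)$, and functions $R:\mathbb R\to\mathbb R$, $N:\mathbb R\to\mathbb Z_{\ge0}$. Then there is $M\in\mathbb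 Z_{>0}$, depending only on $\delta,T,K,R,N$, such that the following holds for every group $\Gamma$ acting on a $\delta$-hyperbolic space $S$ acylindrically with parameters $R,N$. For $g\in\Gamma$ chiral loxodromic, write $h_{g^M}=h_{w,K+1,x_0}$, where $x_0\in S$ is any point such that $d(x_0,g^mx_0)-\inf_{z}d(z,g^mz)\le\delta$ for some positive divisor $m$ of $M$ with $\tau(g^m)\ge\max\{T,2K+2\}$, and $w$ is any geodesic from $x_0$ to $g^Mx_0$. (1) For every chiral loxodromic $g\in\Gamma$ we have $\tau(g^M)\ge\max\{T,2K+2\}$, and $\overline{h_{g^M}}(g)\ge\frac1M$ for every such choice of $x_0$ and $w$. (2) Let $A\subset\Gamma$ be a symmetric subset containing every element of finite order. Choose $x_0$ and $w$ as above for each chiral loxodromic $g\in\Gamma$, and suppose that there is a constant $C>0$ such that $\sup\{|\overline{h_{g^M}}(a)|: a\in A\}\le C$ for every chiral loxodromic $g\in\Gamma$. Then (i) a loxodromic element $g\in\Gamma$ is achiral if and only if $\overline{\nu_A}(g)=0$; (ii) there is a constant $\Theta>0$ such that $\overline{\nu_A}(g)\ge\Theta$ for every chiral loxodromic element $g\in\Gamma$.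 -/

import Mathlib

open Filter Topology Set

noncomputable section

namespace GapThm

/-! ### Paths, geodesics, hyperbolic spaces -/

/-- A rectifiable path in a metric space, parametrized by arc length on `[0, len]`.
Only the values of `toFun` on `[0, len]` matter. -/
structure ArcPath (S : Type*) [MetricSpace S] where
  len : ℝ
  toFun : ℝ → S
  len_nonneg : 0 ≤ len
  unit_speed : HasUnitSpeedOn toFun (Icc 0 len)

namespace ArcPath

variable {S : Type*} [MetricSpace S]

/-- The path starts at `x` and ends at `y`. -/
def Joins (p : ArcPath S) (x y : S) : Prop :=
  p.toFun 0 = x ∧ p.toFun p.len = y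

def image (p : ArcPath S) : Set S := p.toFun '' Icc 0 p.len

def IsGeodesic (p : ArcPath S) : Prop :=
  ∀ s ∈ Icc 0 p.len, ∀ t ∈ Icc 0 p.len, dist (p.toFun s) (p.toFun t) = |s - t|

/-- The inverse path `w⁻¹`, i.e. `w` run backwards. -/
def reverse (p : ArcPath S) : ArcPath S where
  len := p.len
  toFun := fun t => p.toFun (p.len - t)
  len_nonneg := p.len_nonneg
  unit_speed := by
    intro x hx y hy
    have h := p.unit_speed (x := p.len - y) ⟨by linarith [hy.2], by linarith [hy.1]⟩
      (y := p.len - x) ⟨by linarith [hx.2], by linarith [hx.1]⟩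
    have e : (fun t => p.len - t) '' (Icc 0 p.len ∩ Icc x y)
        = Icc 0 p.len ∩ Icc (p.len - y) (p.len - x) := by
      ext u
      constructor
      · rintro ⟨t, ⟨⟨h1, h2⟩, h3, h4⟩, rfl⟩
        exact ⟨⟨by simp only; linarith, by simp only; linarith⟩,
          by simp only; linarith, by simp only; linarith⟩
      · rintro ⟨⟨h1, h2⟩, h3, h4⟩
        exact ⟨p.len - u, ⟨⟨by linarith, by linarith⟩, by linarith, by linarith⟩, by simp⟩
    have hc := eVariationOn.comp_eq_of_antitoneOn p.toFun (t := Icc 0 p.len ∩ Icc x y)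
      (fun t => p.len - t) (fun a _ b _ hab => by simp only; linarith)
    rw [e, h] at hc
    have : p.len - x - (p.len - y) = y - x := by ring
    rw [this] at hc
    exact hc

end ArcPath

/-- Each side of the triangle is contained in the closed `δ`-neighbourhood of the union of the
other two sides. -/
def IsSlim {S : Type*} [MetricSpace S] (δ : ℝ) (p q r : ArcPath S) : Prop :=
  p.image ⊆ Metric.cthickening δ (q.image ∪ r.image) ∧
  q.image ⊆ Metric.cthickening δ (r.image ∪ p.image) ∧
  r.image ⊆ Metric.cthickening δ (p.image ∪ q.image)

/-- `δ`-hyperbolic geodesic metric spaces. -/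
structure IsHyperbolic (δ : ℝ) (S : Type*) [MetricSpace S] : Prop where
  geodesic : ∀ x y : S, ∃ p : ArcPath S, p.IsGeodesic ∧ p.Joins x y
  slim : ∀ (x y z : S) (p q r : ArcPath S),
    p.IsGeodesic → q.IsGeodesic → r.IsGeodesic →
    p.Joins x y → q.Joins y z → r.Joins z x → IsSlim δ p q r

/-! ### Isometric actions -/

section Action

variable {Γ : Type*} [Group Γ] {S : Type*} [MetricSpace S] [MulAction Γ S]

variable (S) in
/-- `τ(g) = lim d(x, gⁿ x) / n`; the limit exists and does not depend on the point `x`. -/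
def translationLength [Nonempty S] (g : Γ) : ℝ :=
  limUnder atTop fun n : ℕ =>
    dist (Classical.arbitrary S) (g ^ n • Classical.arbitrary S) / n

variable (S) in
def IsLoxodromic [Nonempty S] (g : Γ) : Prop := 0 < translationLength S g

variable (Γ S) in
/-- The action is acylindrical with parameters `r ↦ (R r, N r)`. -/
def AcylindricalWith (R : ℝ → ℝ) (N : ℝ → ℕ) : Prop :=
  ∀ r : ℝ, 0 < r → ∀ x x' : S, R r ≤ dist x x' →
    {g : Γ | dist x (g • x) ≤ r ∧ dist x' (g • x') ≤ r}.encard ≤ N r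

/-- The displacement of `g` at `x` is within `δ` of its infimum. -/
def AlmostMinimal (δ : ℝ) (g : Γ) (x : S) : Prop :=
  dist x (g • x) - ⨅ z : S, dist z (g • z) ≤ δ

end Action

/-- `T, K > 0` are such that for every isometric action on a `δ`-hyperbolic space, every `g` with
`τ(g) ≥ T`, every point `x` of `δ`-almost minimal displacement and every `i ≥ 0`,
`i τ(g) ≤ d(x, gⁱ x) ≤ i τ(g) + K`. -/
def DisplacementConstants.{u, v} (δ T K : ℝ) : Prop :=
  0 < T ∧ 0 < K ∧
  ∀ (Γ : Type u) [Group Γ] (S : Type v) [MetricSpace S] [Nonempty S] [MulAction Γ S]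
    [IsIsometricSMul Γ S], IsHyperbolic δ S →
    ∀ g : Γ, T ≤ translationLength S g → ∀ x : S, AlmostMinimal δ g x → ∀ i : ℕ,
      i * translationLength S g ≤ dist x (g ^ i • x) ∧
      dist x (g ^ i • x) ≤ i * translationLength S g + K

/-! ### Epstein--Fujiwara quasimorphisms -/

section Counting

variable (Γ : Type*) [Group Γ] {S : Type*} [MetricSpace S] [MulAction Γ S]

/-- `α` contains `n` non-overlapping oriented copies of `w` as subpaths: `s i` is the starting
time in `α` of the copy `g i • w`. Consecutive copies may share an endpoint. -/
def HasCopies (w α : ArcPath S) (n : ℕ) : Prop :=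
  ∃ (s : Fin n → ℝ) (g : Fin n → Γ),
    (∀ i, 0 ≤ s i ∧ s i + w.len ≤ α.len) ∧
    (∀ i, ∀ t ∈ Icc 0 w.len, α.toFun (s i + t) = g i • w.toFun t) ∧
    Pairwise fun i j => w.len ≤ |s i - s j|

/-- `|α|_w`, the maximal number of non-overlapping copies of `w` in `α` (for `|w| > 0`). -/
def copyCount (w α : ArcPath S) : ℕ := sSup {n | HasCopies Γ w α n}

/-- `c_{w,W}([x,y]) = d(x,y) - inf_α (|α| - W |α|_w)`. -/
def countingFunction (w : ArcPath S) (W : ℝ) (x y : S) : ℝ :=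
  dist x y - sInf {b : ℝ | ∃ α : ArcPath S, α.Joins x y ∧ b = α.len - W * copyCount Γ w α}

variable {Γ} in
/-- `h_{w,W,x₀}(a) = c_{w,W}([x₀, a x₀]) - c_{w⁻¹,W}([x₀, a x₀])`. -/
def epsteinFujiwara (w : ArcPath S) (W : ℝ) (x₀ : S) (a : Γ) : ℝ :=
  countingFunction Γ w W x₀ (a • x₀) - countingFunction Γ w.reverse W x₀ (a • x₀)

end Counting

section Groups

variable {Γ : Type*} [Group Γ]

/-- `ψ̄(g) = lim ψ(gⁿ) / n`. -/
def homogenization (ψ : Γ → ℝ) (g : Γ) : ℝ :=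
  limUnder atTop fun n : ℕ => ψ (g ^ n) / n

/-- `a` is achiral if `aᵐ` is conjugate to `a⁻ᵐ` for some `m > 0`. -/
def IsAchiral (a : Γ) : Prop := ∃ m : ℕ, 0 < m ∧ IsConj (a ^ m) (a ^ m)⁻¹

/-- The word norm of `g ∈ ⟨A⟩` with respect to a symmetric set `A`. -/
def wordNorm (A : Set Γ) (g : Γ) : ℕ :=
  sInf {n | ∃ l : List Γ, l.length = n ∧ (∀ a ∈ l, a ∈ A) ∧ l.prod = g}

/-- The stable word norm, for elements of `⟨A⟩`. -/
def stableWordNormAux (A : Set Γ) (g : Γ) : ℝ :=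
  limUnder atTop fun n : ℕ => (wordNorm A (g ^ n) : ℝ) / n

open Classical in
/-- The stable word norm on all of `Γ`: its value at `g` is the stable norm of `gᵐ` divided by `m`
if `gᵐ ∈ ⟨A⟩` for some `m > 0` (the value is independent of `m`; the least one is taken), and `∞`
if there is no such `m`. -/
def stableWordNorm (A : Set Γ) (g : Γ) : ENNReal :=
  if h : ∃ m : ℕ, 0 < m ∧ g ^ m ∈ Subgroup.closure A then
    ENNReal.ofReal (stableWordNormAux A (g ^ Nat.find h) / Nat.find h)
  else ⊤

end Groups

/-- The choices that enter the quasimorphism `h_{g^M}`: `w` is a geodesic from `x₀` to `g^M x₀`,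
where the displacement of `gᵐ` is `δ`-almost minimal at `x₀`, for some divisor `m` of `M` with
`τ(gᵐ) ≥ max {T, 2K + 2}`. -/
def Admissible {Γ : Type*} [Group Γ] {S : Type*} [MetricSpace S] [Nonempty S] [MulAction Γ S]
    (δ T K : ℝ) (M : ℕ) (g : Γ) (x₀ : S) (w : ArcPath S) : Prop :=
  (∃ m : ℕ, m ∣ M ∧ max T (2 * K + 2) ≤ translationLength S (g ^ m) ∧
    AlmostMinimal δ (g ^ m) x₀) ∧
  w.IsGeodesic ∧ w.Joins x₀ (g ^ M • x₀)

end GapThm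

end

universe u v

/-! Let c(x,y) be `pathCost`, the least length of a path from x to y when every copy of w is
refunded W = K+1. For |w| ≥ 2W it is a Γ-invariant asymmetric pseudo-distance, and h(a) = c(a x₀,
x₀) − c(x₀, a x₀). Almost minimizing paths are quasi-geodesics with constants depending only on W,
so by the Morse lemma costs split, up to a bounded error, at the centre of a triangle; hence the
defect of h is bounded in terms of δ and W alone (`exists_defect_bound`).

Along the axis of g one has |w| ≤ Mτ(g)+K, so the refund K+1 brings the forward cost of a period
down to Mτ(g)−1. For chiral g the backward cost never drops below the distance: a copy of w⁻¹ on an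
almost minimizing path would mean that some γ lays a long piece of the axis back along the axis in
reverse. Then the elements g⁻ⁱγg⁻ⁱγ⁻¹ with i ≤ N(r) all displace two distant points by at most r,
acylindricity makes two of them equal, and γ conjugates a power of g to its inverse
(`AcylindricalWith.isAchiral_of_reversed_segment`, `exists_dist_le_pathCost_reverse`). So h gains at
least 1 per period (`one_div_le_homogenization`). A uniform lower bound on τ lets one M serve all
loxodromic elements.

The gap follows by comparing h on long words in A with the uniform defect
(`abs_homogenization_le_stableWordNormAux`). Conversely, if t inverts a power gᵐ of a loxodromic g,
then t has finite order (`AcylindricalWith.isOfFinOrder_of_inverts`), and every power of g²ᵐ is a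
product of two torsion elements.

The displacement constants of (0) come from the fact that an orbit of almost minimal displacement
cannot backtrack (`AlmostMinimal.dist_pow_smul_le`). -/

noncomputable section

namespace GapThm

/-! ### Slim triangles and the four-point condition. -/

section Paths

variable {S : Type*} [MetricSpace S]

/-- The four-point condition for Gromov hyperbolicity. -/
def FourPoint (Δ : ℝ) (S : Type*) [MetricSpace S] : Prop :=
  ∀ x y z w : S,
    dist x y + dist z w ≤ max (dist x z + dist y w) (dist x w + dist y z) + Δ

theorem FourPoint.or {Δ : ℝ} (h : FourPoint Δ S) (x y z w : S) :
    dist x y + dist z w ≤ dist x z + dist y w + Δ ∨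
      dist x y + dist z w ≤ dist x w + dist y z + Δ := by
  have := h x y z w
  rcases le_total (dist x z + dist y w) (dist x w + dist y z) with h' | h'
  · rw [max_eq_right h'] at this; exact Or.inr this
  · rw [max_eq_left h'] at this; exact Or.inl this

theorem FourPoint.nonneg [Nonempty S] {Δ : ℝ} (h : FourPoint Δ S) : 0 ≤ Δ := by
  obtain ⟨x⟩ := ‹Nonempty S›
  simpa using h x x x x

theorem continuousOn_of_dist_le_abs_sub {f : ℝ → S} {A : Set ℝ}
    (h : ∀ s ∈ A, ∀ t ∈ A, dist (f s) (f t) ≤ |s - t|) : ContinuousOn f A := by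
  have : LipschitzOnWith 1 f A := by
    refine LipschitzOnWith.of_dist_le_mul fun s hs t ht => ?_
    simpa [Real.dist_eq] using h s hs t ht
  exact this.continuousOn

namespace ArcPath

theorem dist_le (p : ArcPath S) {s t : ℝ} (hs : s ∈ Icc 0 p.len) (ht : t ∈ Icc 0 p.len) :
    dist (p.toFun s) (p.toFun t) ≤ |s - t| := by
  wlog hst : s ≤ t generalizing s t
  · rw [dist_comm, abs_sub_comm]
    exact this ht hs (le_of_not_ge hst)
  have h1 := p.unit_speed hs ht
  have h2 : edist (p.toFun s) (p.toFun t) ≤ eVariationOn p.toFun (Icc 0 p.len ∩ Icc s t) :=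
    eVariationOn.edist_le _ ⟨hs, le_rfl, hst⟩ ⟨ht, hst, le_rfl⟩
  rw [h1, edist_le_ofReal (by simpa using hst)] at h2
  rw [abs_sub_comm, abs_of_nonneg (by linarith)]
  simpa using h2

theorem zero_mem (p : ArcPath S) : (0 : ℝ) ∈ Icc 0 p.len := ⟨le_rfl, p.len_nonneg⟩

theorem len_mem (p : ArcPath S) : p.len ∈ Icc 0 p.len := ⟨p.len_nonneg, le_rfl⟩

theorem continuousOn (p : ArcPath S) : ContinuousOn p.toFun (Icc 0 p.len) :=
  continuousOn_of_dist_le_abs_sub fun _ hs _ ht => p.dist_le hs ht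

theorem Joins.dist_le {p : ArcPath S} {x y : S} (h : p.Joins x y) : dist x y ≤ p.len := by
  have := p.dist_le p.zero_mem p.len_mem
  rw [h.1, h.2, zero_sub, abs_neg, abs_of_nonneg p.len_nonneg] at this
  exact this

theorem IsGeodesic.len_eq {p : ArcPath S} (hp : p.IsGeodesic) {x y : S} (h : p.Joins x y) :
    p.len = dist x y := by
  have := hp 0 p.zero_mem p.len p.len_mem
  rw [h.1, h.2, zero_sub, abs_neg, abs_of_nonneg p.len_nonneg] at this
  exact this.symm

theorem IsGeodesic.dist_left {p : ArcPath S} (hp : p.IsGeodesic) {x y : S} (h : p.Joins x y)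
    {t : ℝ} (ht : t ∈ Icc 0 p.len) : dist x (p.toFun t) = t := by
  have := hp 0 p.zero_mem t ht
  rw [h.1, zero_sub, abs_neg, abs_of_nonneg ht.1] at this
  exact this

theorem IsGeodesic.dist_right {p : ArcPath S} (hp : p.IsGeodesic) {x y : S} (h : p.Joins x y)
    {t : ℝ} (ht : t ∈ Icc 0 p.len) : dist (p.toFun t) y = p.len - t := by
  have := hp t ht p.len p.len_mem
  rw [h.2, abs_sub_comm, abs_of_nonneg (by linarith [ht.2])] at this
  exact this

theorem Joins.reverse {p : ArcPath S} {x y : S} (h : p.Joins x y) : p.reverse.Joins y x := by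
  constructor <;> simp [ArcPath.reverse, h.1, h.2]

/-- A point close to a geodesic is almost between its endpoints. -/
theorem IsGeodesic.dist_add_dist_le_of_mem_cthickening {p : ArcPath S} (hp : p.IsGeodesic)
    {x y : S} (h : p.Joins x y) {δ : ℝ} (hδ : 0 < δ) {z : S}
    (hz : z ∈ Metric.cthickening δ p.image) : dist x z + dist z y ≤ dist x y + 4 * δ := by
  -- The closed neighbourhood is defined by an infimum; doubling the radius yields an actual nearby
  -- point, hence 4δ instead of 2δ.
  have h2 : z ∈ Metric.thickening (2 * δ) p.image :=
    Metric.cthickening_subset_thickening' (by linarith) (by linarith) _ hz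
  obtain ⟨q, ⟨t, ht, rfl⟩, hq⟩ := Metric.mem_thickening_iff.1 h2
  have h3 := hp.dist_left h ht
  have h4 := hp.dist_right h ht
  have h5 := hp.len_eq h
  have h6 := dist_triangle x (p.toFun t) z
  have h7 := dist_triangle z (p.toFun t) y
  rw [dist_comm (p.toFun t) z] at h6
  linarith

end ArcPath

/-- The side [x,y] is connected and covered by the closed neighbourhoods of the other two sides, so
some point of it is near both. -/
theorem IsHyperbolic.exists_center {δ : ℝ} (hδ : 0 < δ) (hS : IsHyperbolic δ S) {x y : S}
    {p : ArcPath S} (hp : p.IsGeodesic) (hxy : p.Joins x y) (z : S) :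
    ∃ t ∈ Icc 0 p.len,
      dist x (p.toFun t) + dist (p.toFun t) z ≤ dist x z + 4 * δ ∧
      dist y (p.toFun t) + dist (p.toFun t) z ≤ dist y z + 4 * δ := by
  obtain ⟨q, hq, hyz⟩ := hS.geodesic y z
  obtain ⟨r, hr, hzx⟩ := hS.geodesic z x
  have hslim := (hS.slim x y z p q r hp hq hr hxy hyz hzx).1
  have hI : IsPreconnected (Icc 0 p.len) := isPreconnected_Icc
  have hI' : IsPreconnected (p.image) := hI.image _ p.continuousOn
  have := isPreconnected_closed_iff.1 hI' (Metric.cthickening δ q.image)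
    (Metric.cthickening δ r.image) Metric.isClosed_cthickening Metric.isClosed_cthickening
    (by rw [← Metric.cthickening_union]; exact hslim)
    ⟨y, ⟨p.len, p.len_mem, hxy.2⟩, Metric.self_subset_cthickening _ ⟨0, q.zero_mem, hyz.1⟩⟩
    ⟨x, ⟨0, p.zero_mem, hxy.1⟩, Metric.self_subset_cthickening _ ⟨r.len, r.len_mem, hzx.2⟩⟩
  obtain ⟨_, ⟨t, ht, rfl⟩, h1, h2⟩ := this
  refine ⟨t, ht, ?_, hq.dist_add_dist_le_of_mem_cthickening hyz hδ h1⟩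
  have := hr.dist_add_dist_le_of_mem_cthickening hzx hδ h2
  rw [dist_comm x z, dist_comm x, dist_comm _ z]
  linarith

/-- Both z and w are projected to centres on [x,y]; the order of these centres along [x,y] decides
which pairing dominates. -/
theorem IsHyperbolic.fourPoint {δ : ℝ} (hδ : 0 < δ) (hS : IsHyperbolic δ S) :
    FourPoint (8 * δ) S := by
  intro x y z w
  obtain ⟨p, hp, hxy⟩ := hS.geodesic x y
  obtain ⟨s, hs, hs1, hs2⟩ := hS.exists_center hδ hp hxy z
  obtain ⟨t, ht, ht1, ht2⟩ := hS.exists_center hδ hp hxy w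
  have e1 := hp.dist_left hxy hs
  have e2 := hp.dist_left hxy ht
  have e3 := hp.dist_right hxy hs
  have e4 := hp.dist_right hxy ht
  have e5 := hp.len_eq hxy
  have e6 := hp s hs t ht
  have t1 := dist_triangle4 z (p.toFun s) (p.toFun t) w
  rw [dist_comm _ z] at hs1 hs2
  rw [dist_comm _ y] at e3 e4
  rcases le_total s t with hst | hst
  · rw [abs_sub_comm, abs_of_nonneg (by linarith)] at e6
    have : dist x y + dist z w ≤ dist x w + dist y z + 8 * δ := by linarith
    exact this.trans (by gcongr; exact le_max_right _ _)
  · rw [abs_of_nonneg (by linarith)] at e6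
    have : dist x y + dist z w ≤ dist x z + dist y w + 8 * δ := by linarith
    exact this.trans (by gcongr; exact le_max_left _ _)

/-- A point almost between the endpoints of a geodesic is close to it. -/
theorem FourPoint.exists_dist_le_of_almost_between {Δ : ℝ} (hΔ : FourPoint Δ S)
    {x z : S} {p : ArcPath S} (hp : p.IsGeodesic) (hxz : p.Joins x z) {q : S} {C : ℝ}
    (hC : 0 ≤ C) (hq : dist x q + dist q z ≤ dist x z + C) :
    ∃ t ∈ Icc 0 p.len, dist q (p.toFun t) ≤ C + Δ := by
  have hn : Nonempty S := ⟨x⟩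
  have hΔ0 := hΔ.nonneg
  have hl := hp.len_eq hxz
  rcases le_total (dist x q) p.len with h | h
  · have ht : dist x q ∈ Icc 0 p.len := ⟨dist_nonneg, h⟩
    refine ⟨dist x q, ht, ?_⟩
    have h1 := hp.dist_left hxz ht
    have h2 := hp.dist_right hxz ht
    rcases hΔ.or q (p.toFun (dist x q)) x z with h3 | h3 <;>
    · linarith [dist_comm q x, dist_comm (p.toFun (dist x q)) x]
  · refine ⟨p.len, p.len_mem, ?_⟩
    rw [hxz.2]
    linarith

end Paths

/-! ### Translation length and orbits of almost minimal displacement. -/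

section TranslationLength

set_option linter.unusedSectionVars false

variable {Γ : Type*} [Group Γ] {S : Type*} [MetricSpace S] [MulAction Γ S] [IsIsometricSMul Γ S]

theorem subadditive_dist_pow_smul (g : Γ) (x : S) :
    Subadditive fun n : ℕ => dist x (g ^ n • x) := by
  intro m n
  simp only [pow_add, mul_smul]
  calc dist x (g ^ m • g ^ n • x)
      ≤ dist x (g ^ m • x) + dist (g ^ m • x) (g ^ m • g ^ n • x) := dist_triangle _ _ _
    _ = _ := by rw [dist_smul]

theorem bddBelow_dist_pow_smul_div (g : Γ) (x : S) :
    BddBelow (range fun n : ℕ => dist x (g ^ n • x) / n) :=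
  ⟨0, by rintro _ ⟨n, rfl⟩; positivity⟩

theorem AlmostMinimal.dist_le {δ : ℝ} {g : Γ} {x : S} (h : AlmostMinimal δ g x) (z : S) :
    dist x (g • x) ≤ dist z (g • z) + δ := by
  have h1 : (⨅ z : S, dist z (g • z)) ≤ dist z (g • z) :=
    ciInf_le ⟨0, by rintro _ ⟨n, rfl⟩; positivity⟩ z
  unfold AlmostMinimal at h
  linarith

/-- At a point of almost minimal displacement, the orbit makes no sharp turns. -/
theorem AlmostMinimal.two_mul_dist_le {δ Δ : ℝ} (hS : IsHyperbolic δ S) (hΔ : FourPoint Δ S)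
    {g : Γ} {x : S} (h : AlmostMinimal δ g x) (hL : δ + 2 * Δ < dist x (g • x)) :
    2 * dist x (g • x) ≤ dist x (g ^ 2 • x) + (δ + 2 * Δ) := by
  have : Nonempty S := ⟨x⟩
  have hΔ0 := hΔ.nonneg
  obtain ⟨p, hp, hj⟩ := hS.geodesic x (g • x)
  have hl := hp.len_eq hj
  have ht : p.len / 2 ∈ Icc 0 p.len := ⟨by linarith [p.len_nonneg], by linarith [p.len_nonneg]⟩
  have h1 := hp.dist_left hj ht
  have h2 := hp.dist_right hj ht
  -- If the orbit turned back at gx, the midpoint q of [x, gx] would be close to gq, the midpoint of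
  -- the next segment, and q would be displaced by less than almost minimality of x permits.
  set q := p.toFun (p.len / 2)
  have h3 := h.dist_le q
  have h4 : dist (g • x) (g • q) = dist x q := dist_smul _ _ _
  have h5 : dist (g • q) (g ^ 2 • x) = dist q (g • x) := by
    rw [pow_two, mul_smul, dist_smul]
  have h6 : dist (g • x) (g ^ 2 • x) = dist x (g • x) := by
    rw [pow_two, mul_smul, dist_smul]
  have c1 := dist_comm (g • x) q
  have c2 := dist_comm (g • q) (g • x)
  have h7 : dist x (g • x) + dist q (g • q) ≤ dist x (g • q) + dist (g • x) q + Δ := by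
    rcases hΔ.or x (g • x) q (g • q) with h | h <;> linarith
  rcases hΔ.or x (g • q) (g • x) (g ^ 2 • x) with h | h <;> linarith

theorem dist_pow_smul_pow_smul (g : Γ) (x : S) (m n : ℕ) :
    dist (g ^ m • x) (g ^ (m + n) • x) = dist x (g ^ n • x) := by
  rw [pow_add, mul_smul, dist_smul]

variable [Nonempty S]

theorem tendsto_translationLength (g : Γ) (x : S) :
    Tendsto (fun n : ℕ => dist x (g ^ n • x) / n) atTop (𝓝 (translationLength S g)) := by
  set o := Classical.arbitrary S with ho
  have h1 : Tendsto (fun n : ℕ => dist o (g ^ n • o) / n) atTop (𝓝 (translationLength S g)) :=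
    tendsto_nhds_limUnder ⟨_, (subadditive_dist_pow_smul g o).tendsto_lim
      (bddBelow_dist_pow_smul_div g o)⟩
  have h2 : Tendsto (fun n : ℕ => dist x (g ^ n • x) / n - dist o (g ^ n • o) / n)
      atTop (𝓝 0) := by
    refine squeeze_zero_norm (a := fun n : ℕ => 2 * dist x o / n) (fun n => ?_)
      (tendsto_const_div_atTop_nhds_zero_nat _)
    rw [← sub_div, norm_div, Real.norm_natCast, Real.norm_eq_abs]
    gcongr
    have a1 := dist_triangle4 x o (g ^ n • o) (g ^ n • x)
    have a2 := dist_triangle4 o x (g ^ n • x) (g ^ n • o)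
    rw [dist_smul] at a1 a2
    rw [abs_le]
    constructor <;> linarith [dist_comm x o]
  simpa using h2.add h1

theorem mul_translationLength_le (g : Γ) (x : S) (n : ℕ) :
    n * translationLength S g ≤ dist x (g ^ n • x) := by
  rcases eq_or_ne n 0 with rfl | hn
  · simp
  have h1 := (subadditive_dist_pow_smul g x).lim_le_div (bddBelow_dist_pow_smul_div g x) hn
  have h2 := tendsto_nhds_unique (tendsto_translationLength g x)
    ((subadditive_dist_pow_smul g x).tendsto_lim (bddBelow_dist_pow_smul_div g x))
  rw [← h2, le_div_iff₀ (by positivity)] at h1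
  linarith

theorem le_translationLength {g : Γ} {x : S} {c : ℝ}
    (h : ∀ n : ℕ, n * c ≤ dist x (g ^ n • x)) : c ≤ translationLength S g := by
  refine ge_of_tendsto (tendsto_translationLength g x) ?_
  filter_upwards [eventually_gt_atTop 0] with n hn
  rw [le_div_iff₀ (by positivity)]
  linarith [h n]

theorem translationLength_nonneg (g : Γ) : 0 ≤ translationLength S g :=
  le_translationLength (x := Classical.arbitrary S) (by simp)

theorem translationLength_pow (g : Γ) (m : ℕ) :
    translationLength S (g ^ m) = m * translationLength S g := by
  rcases Nat.eq_zero_or_pos m with rfl | hm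
  · have h := mul_translationLength_le (1 : Γ) (Classical.arbitrary S) 1
    rw [one_pow, one_smul, dist_self, Nat.cast_one, one_mul] at h
    rw [pow_zero, Nat.cast_zero, zero_mul]
    exact le_antisymm h (translationLength_nonneg _)
  let x := Classical.arbitrary S
  refine tendsto_nhds_unique (tendsto_translationLength (g ^ m) x) ?_
  have h := ((tendsto_translationLength g x).comp
    (tendsto_id.const_mul_atTop' hm)).const_mul (m : ℝ)
  refine h.congr fun n => ?_
  rcases Nat.eq_zero_or_pos n with rfl | hn
  · simp
  simp only [Function.comp, id, pow_mul, Nat.cast_mul]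
  field_simp

theorem exists_almostMinimal {δ : ℝ} (hδ : 0 < δ) (g : Γ) : ∃ x : S, AlmostMinimal δ g x := by
  obtain ⟨x, hx⟩ := exists_lt_of_ciInf_lt
    (show (⨅ z : S, dist z (g • z)) < (⨅ z : S, dist z (g • z)) + δ by linarith)
  exact ⟨x, by unfold AlmostMinimal; linarith⟩

/-- Existence of the constants in the displacement estimate. -/
theorem AlmostMinimal.dist_pow_smul_le {δ Δ : ℝ} (hδ : 0 < δ) (hS : IsHyperbolic δ S)
    (hΔ : FourPoint Δ S) {g : Γ} {x : S} (h : AlmostMinimal δ g x)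
    (hL : 2 * δ + 6 * Δ ≤ dist x (g • x)) (n : ℕ) :
    dist x (g ^ n • x) ≤ n * translationLength S g + (δ + 4 * Δ) := by
  have hΔ0 := hΔ.nonneg
  set L := dist x (g • x) with hLdef
  let a : ℕ → ℝ := fun n => dist x (g ^ n • x)
  have ha : ∀ m n, dist (g ^ m • x) (g ^ (m + n) • x) = a n := dist_pow_smul_pow_smul g x
  have a1 : a 1 = L := by simp [a, hLdef]
  have a2 : 2 * L ≤ a 2 + (δ + 2 * Δ) := h.two_mul_dist_le hS hΔ (by linarith)
  -- Local to global: the wrong four-point alternative together with the induction hypothesis gives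
  -- a 2 ≤ δ + 4Δ, which contradicts `a2` for large L.
  have step : ∀ n, a n + L ≤ a (n + 1) + (δ + 3 * Δ) := by
    intro n
    induction n with
    | zero => simp only [zero_add, a1]; simp [a]; linarith
    | succ n ih =>
      rcases hΔ.or x (g ^ (n + 1) • x) (g ^ n • x) (g ^ (n + 2) • x) with h | h
      · rw [ha n 2, show n + 2 = (n + 1) + 1 from rfl, ha (n + 1) 1] at h
        change a (n + 1) + a 2 ≤ a n + a 1 + Δ at h
        linarith
      · rw [ha n 2, dist_comm (g ^ (n + 1) • x), ha n 1] at h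
        change a (n + 1) + a 2 ≤ a (n + 2) + a 1 + Δ at h
        change a (n + 1) + L ≤ a (n + 2) + _
        linarith
  have super : ∀ m n, a m + a n ≤ a (m + n) + (δ + 4 * Δ) := by
    intro m n
    rcases n with _ | n
    · simp [a]; positivity
    · have s1 := step m
      have s2 := step n
      have e : dist (g ^ (m + 1) • x) (g ^ (m + (n + 1)) • x) = a n := by
        rw [show m + (n + 1) = (m + 1) + n by ring, ha]
      rcases hΔ.or x (g ^ (m + 1) • x) (g ^ m • x) (g ^ (m + (n + 1)) • x) with h | h
      · rw [ha m (n + 1), e] at h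
        change a (m + 1) + a (n + 1) ≤ a m + a n + Δ at h
        linarith
      · rw [ha m (n + 1), dist_comm (g ^ (m + 1) • x), ha m 1] at h
        change a (m + 1) + a (n + 1) ≤ a (m + (n + 1)) + a 1 + Δ at h
        linarith
  -- Superadditivity up to a constant makes a (n * j) grow in j at least at the rate a n − (δ + 4Δ).
  have key : a n - (δ + 4 * Δ) ≤ translationLength S (g ^ n) := by
    refine le_translationLength (x := x) fun j => ?_
    rw [← pow_mul]
    induction j with
    | zero => simp
    | succ j ih =>
      have := super (n * j) n
      change j * _ ≤ a (n * j) at ih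
      change _ ≤ a (n * (j + 1))
      rw [mul_add, mul_one]
      push_cast
      linarith
  rw [translationLength_pow] at key
  change a n ≤ _
  linarith

end TranslationLength

theorem exists_displacementConstants.{u₁, v₁} {δ : ℝ} (hδ : 0 < δ) :
    ∃ T K : ℝ, DisplacementConstants.{u₁, v₁} δ T K := by
  -- The threshold and error of `AlmostMinimal.dist_pow_smul_le` with Δ = 8δ; the bound on τ(g)
  -- passes to d(x, gx) ≥ τ(g).
  refine ⟨2 * δ + 6 * (8 * δ), δ + 4 * (8 * δ), by positivity, by positivity, ?_⟩
  intro Γ _ S _ _ _ _ hS g hg x hx i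
  refine ⟨mul_translationLength_le g x i, ?_⟩
  refine hx.dist_pow_smul_le hδ hS (hS.fourPoint hδ) ?_ i
  have := mul_translationLength_le g x 1
  simp only [Nat.cast_one, one_mul, pow_one] at this
  linarith

/-! ### Points on the axis of a loxodromic element, and elements commuting with it. -/

section Axis

set_option linter.unusedSectionVars false

variable {Γ : Type*} [Group Γ] {S : Type*} [MetricSpace S] [MulAction Γ S] [IsIsometricSMul Γ S]

theorem dist_inv_smul_self (g : Γ) (x : S) : dist (g⁻¹ • x) x = dist x (g • x) := by
  rw [← dist_smul g, smul_inv_smul]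

theorem dist_smul_comm_smul {g h : Γ} (hc : Commute h g) (x : S) :
    dist (g • x) (h • g • x) = dist x (h • x) := by
  rw [smul_smul, hc.eq, mul_smul, dist_smul]

theorem dist_pow_smul_le_mul (h : Γ) (x : S) (j : ℕ) :
    dist x (h ^ j • x) ≤ j * dist x (h • x) := by
  induction j with
  | zero => simp
  | succ j ih =>
    have := subadditive_dist_pow_smul h x j 1
    simp only [pow_one] at this
    push_cast
    linarith

/-- Seen from a far away point `o`, the isometry `h` acts almost like a translation. -/
theorem FourPoint.mul_le_dist_pow_smul {Δ : ℝ} (hΔ : FourPoint Δ S) {h : Γ} {x o : S} {n : ℕ}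
    (ho : ∀ j : ℕ, dist o (h ^ j • o) = dist x (h ^ j • x))
    (hbig : 2 * (n + 1) * dist x (h • x) + Δ < 2 * dist o x) :
    n * (dist o (h • x) - dist o x - Δ) ≤ dist x (h ^ n • x) := by
  set D := dist x (h • x) with hD
  have hD0 : 0 ≤ D := dist_nonneg
  have step : ∀ j : ℕ, j ≤ n → dist o (h ^ j • x) + dist o (h • x)
      ≤ dist o (h ^ (j + 1) • x) + dist o x + Δ := by
    intro j hj
    have e1 : dist ((h ^ j)⁻¹ • o) x = dist o (h ^ j • x) := by
      rw [← dist_smul (h ^ j), smul_inv_smul]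
    have e2 : dist ((h ^ j)⁻¹ • o) (h • x) = dist o (h ^ (j + 1) • x) := by
      rw [← dist_smul (h ^ j), smul_inv_smul, pow_succ, mul_smul]
    have e3 : dist ((h ^ j)⁻¹ • o) o ≤ j * D := by
      rw [dist_inv_smul_self, ho]
      exact dist_pow_smul_le_mul h x j
    -- The point o is moved by h⁻ʲ much less than its distance to x, which rules out the first
    -- pairing. The second says that the distance from o grows at each step by the initial gain, up
    -- to Δ.
    rcases hΔ.or ((h ^ j)⁻¹ • o) x o (h • x) with h1 | h1
    · exfalso
      have t1 := dist_triangle o ((h ^ j)⁻¹ • o) x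
      have t2 := dist_triangle o (h • x) x
      have : (j : ℝ) * D ≤ n * D := by gcongr
      linarith [dist_comm o ((h ^ j)⁻¹ • o), dist_comm (h • x) x]
    · linarith [dist_comm o x]
  have key : ∀ j : ℕ, j ≤ n →
      j * (dist o (h • x) - dist o x - Δ) ≤ dist o (h ^ j • x) - dist o x := by
    intro j
    induction j with
    | zero => simp
    | succ j ih =>
      intro hj
      have := ih (by omega)
      have := step j (by omega)
      push_cast
      linarith
  have := key n le_rfl
  linarith [dist_triangle o x (h ^ n • x)]

variable [Nonempty S]

variable (S) in
theorem not_isOfFinOrder_of_isLoxodromic {g : Γ} (hg : IsLoxodromic S g) : ¬ IsOfFinOrder g := by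
  rw [isOfFinOrder_iff_pow_eq_one]
  rintro ⟨n, hn, h⟩
  have := mul_translationLength_le g (Classical.arbitrary S) n
  rw [h, one_smul, dist_self] at this
  have h2 : 0 < (n : ℝ) * translationLength S g := mul_pos (by exact_mod_cast hn) hg
  linarith

/-- The orbit of `x` under the loxodromic element `G` is a quasi-geodesic with multiplicative
constant one. -/
def IsAxisPoint (K : ℝ) (G : Γ) (x : S) : Prop :=
  0 < translationLength S G ∧ ∀ n : ℕ, dist x (G ^ n • x) ≤ n * translationLength S G + K

namespace IsAxisPoint

variable {K Δ : ℝ} {G : Γ} {x : S}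

theorem nonneg (h : IsAxisPoint K G x) : 0 ≤ K := by simpa using h.2 0

theorem exists_le_dist (h : IsAxisPoint K G x) (C : ℝ) : ∃ k : ℕ, C ≤ dist x (G ^ k • x) := by
  obtain ⟨k, hk⟩ := exists_nat_ge (C / translationLength S G)
  refine ⟨k, le_trans ?_ (mul_translationLength_le G x k)⟩
  rwa [div_le_iff₀ h.1] at hk

theorem two_mul_dist_le (h : IsAxisPoint K G x) (k : ℕ) :
    2 * dist x (G ^ k • x) ≤ dist ((G ^ k)⁻¹ • x) (G ^ k • x) + 2 * K := by
  have h1 : dist ((G ^ k)⁻¹ • x) (G ^ k • x) = dist x (G ^ (k + k) • x) := by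
    rw [← dist_smul (G ^ k), smul_inv_smul, smul_smul, pow_add]
  have h2 := mul_translationLength_le G x (k + k)
  have h3 := h.2 k
  rw [h1]
  push_cast at h2
  linarith

/-- Since x is almost between G⁻ᵏx and Gᵏx, leaving x means moving away from at least one of these
ends at nearly full speed. -/
theorem dist_le_or (h : IsAxisPoint K G x) (hΔ : FourPoint Δ S) (k : ℕ) (y : S) :
    dist x y ≤ dist ((G ^ k)⁻¹ • x) y - dist ((G ^ k)⁻¹ • x) x + (2 * K + Δ) ∨
      dist x y ≤ dist (G ^ k • x) y - dist (G ^ k • x) x + (2 * K + Δ) := by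
  have h1 := h.two_mul_dist_le k
  have h2 := dist_inv_smul_self (G ^ k) x
  have h3 := dist_comm x (G ^ k • x)
  rcases hΔ.or ((G ^ k)⁻¹ • x) (G ^ k • x) x y with h4 | h4
  · right; linarith
  · left; linarith

/-- An isometry commuting with `G` displaces points of the axis of `G` almost minimally. -/
theorem dist_smul_le_of_commute (h : IsAxisPoint K G x) (hΔ : FourPoint Δ S) {f : Γ}
    (hf : Commute f G) : dist x (f • x) ≤ translationLength S f + (2 * K + 2 * Δ) := by
  suffices dist x (f • x) - (2 * K + 2 * Δ) ≤ translationLength S f by linarith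
  refine le_translationLength (x := x) fun n => ?_
  obtain ⟨k, hk⟩ := h.exists_le_dist (2 * (n + 1) * dist x (f • x) + Δ + 1)
  have h2 := dist_inv_smul_self (G ^ k) x
  have h3 := dist_comm x (G ^ k • x)
  have hΔ0 := hΔ.nonneg
  have hpos : 0 ≤ 2 * ((n : ℝ) + 1) * dist x (f • x) := by positivity
  have hc : ∀ j : ℕ, Commute (f ^ j) (G ^ k) := fun j => hf.pow_pow j k
  -- Commuting with G, f moves the end from which fx recedes exactly as far as it moves x, so that
  -- end serves as the far point o of `FourPoint.mul_le_dist_pow_smul`.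
  rcases h.dist_le_or hΔ k (f • x) with h4 | h4
  · refine le_trans ?_ (hΔ.mul_le_dist_pow_smul (o := (G ^ k)⁻¹ • x)
      (fun j => dist_smul_comm_smul (hc j).inv_right x) (n := n) (by linarith))
    refine mul_le_mul_of_nonneg_left ?_ (Nat.cast_nonneg n)
    linarith
  · refine le_trans ?_ (hΔ.mul_le_dist_pow_smul (o := G ^ k • x)
      (fun j => dist_smul_comm_smul (hc j) x) (n := n) (by linarith))
    refine mul_le_mul_of_nonneg_left ?_ (Nat.cast_nonneg n)
    linarith

/-- A point on the axis of a power of `g` is a point on the axis of `g`. -/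
theorem of_pow {g : Γ} {m : ℕ} (h : IsAxisPoint K (g ^ m) x) (hΔ : FourPoint Δ S) :
    IsAxisPoint (2 * K + 2 * Δ) g x := by
  refine ⟨?_, fun n => ?_⟩
  · have := h.1
    rw [translationLength_pow] at this
    exact pos_of_mul_pos_right this (by positivity)
  · rw [← translationLength_pow]
    exact h.dist_smul_le_of_commute hΔ ((Commute.refl g).pow_pow n m)

/-- Translates of the axis point by elements commuting with `G` stay close to the axis. -/
theorem almost_between (h : IsAxisPoint K G x) (hΔ : FourPoint Δ S) {f : Γ} (hf : Commute f G)
    {k : ℕ} (hk : 2 * K + 4 * dist x (f • x) + Δ < 2 * dist x (G ^ k • x)) :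
    dist ((G ^ k)⁻¹ • x) (f • x) + dist (f • x) (G ^ k • x)
      ≤ dist ((G ^ k)⁻¹ • x) (G ^ k • x) + (2 * K + 2 * Δ) := by
  have hΔ0 := hΔ.nonneg
  have hc : Commute f (G ^ k) := hf.pow_right k
  have b1 := h.two_mul_dist_le k
  have b2 := dist_inv_smul_self (G ^ k) x
  have b3 := dist_comm x (G ^ k • x)
  set o := (G ^ k)⁻¹ • x
  set o' := G ^ k • x
  have e1 : dist o (f • o) = dist x (f • x) := dist_smul_comm_smul hc.inv_right x
  have e2 : dist o' (f • o') = dist x (f • x) := dist_smul_comm_smul hc x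
  have e3 : dist (f • o) (f • o') = dist o o' := dist_smul _ _ _
  have e4 : dist (f • o) (f • x) = dist o x := dist_smul _ _ _
  have e5 : dist (f • o') (f • x) = dist o' x := dist_smul _ _ _
  have t1 := dist_triangle o x (f • x)
  have t2 := dist_triangle o (f • x) x
  have t3 := dist_triangle o' (f • x) x
  have t4 := dist_triangle o (f • o') o'
  have c1 := dist_comm x (f • x)
  have c2 := dist_comm o (f • o)
  have c3 := dist_comm o' (f • o')
  have c4 := dist_comm (f • o') o
  have c5 := dist_comm (f • x) o'
  have c6 := dist_comm (f • o) (f • o')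
  have hD : 0 ≤ dist x (f • x) := dist_nonneg
  -- The point fx lies almost between fo and fo'; these ends are replaced by o and o' one at a time,
  -- at a cost of Δ each. Distance to the ends excludes the other pairing.
  have s1 : dist (f • o) (f • o') + dist o (f • x)
      ≤ dist (f • o) (f • x) + dist (f • o') o + Δ := by
    rcases hΔ.or (f • o) (f • o') o (f • x) with h | h
    · linarith
    · exact h
  rcases hΔ.or o (f • o') o' (f • x) with h | h
  · linarith
  · linarith

end IsAxisPoint

end Axis

/-! ### Consequences of acylindricity: a lower bound on τ, and torsion of inverting elements. -/

section Acylindrical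

set_option linter.unusedSectionVars false

variable {Γ : Type*} [Group Γ] {S : Type*} [MetricSpace S] [MulAction Γ S] [IsIsometricSMul Γ S]

theorem AcylindricalWith.exists_eq_of_dist_le {R : ℝ → ℝ} {N : ℝ → ℕ}
    (h : AcylindricalWith Γ S R N) {r : ℝ} (hr : 0 < r) {x x' : S} (hR : R r ≤ dist x x')
    (f : ℕ → Γ) (hx : ∀ i ≤ N r, dist x (f i • x) ≤ r)
    (hx' : ∀ i ≤ N r, dist x' (f i • x') ≤ r) : ∃ i j, i < j ∧ j ≤ N r ∧ f i = f j := by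
  by_contra! hne
  have hinj : InjOn f (Finset.range (N r + 1) : Set ℕ) := by
    intro i hi j hj hij
    simp only [Finset.coe_range, mem_Iio] at hi hj
    rcases lt_trichotomy i j with hlt | heq | hlt
    · exact absurd hij (hne i j hlt (by omega))
    · exact heq
    · exact absurd hij.symm (hne j i hlt (by omega))
  have h1 := h r hr x x' hR
  have h2 : f '' (Finset.range (N r + 1) : Set ℕ) ⊆
      {g : Γ | dist x (g • x) ≤ r ∧ dist x' (g • x') ≤ r} := by
    rintro _ ⟨i, hi, rfl⟩
    simp only [Finset.coe_range, mem_Iio] at hi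
    exact ⟨hx i (by omega), hx' i (by omega)⟩
  have h3 := (encard_le_encard h2).trans h1
  rw [hinj.encard_image, encard_coe_eq_coe_finsetCard, Finset.card_range] at h3
  have h4 : N r + 1 ≤ N r := by exact_mod_cast h3
  omega

variable [Nonempty S]

/-- Loxodromic elements of an acylindrical action have translation length bounded below. -/
theorem AcylindricalWith.one_le_mul_translationLength {R : ℝ → ℝ} {N : ℝ → ℕ}
    (h : AcylindricalWith Γ S R N) {K : ℝ} {g : Γ} {x : S} (hx : IsAxisPoint K g x) :
    1 ≤ N (K + 1) * translationLength S g := by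
  by_contra! hlt
  have hK := hx.nonneg
  obtain ⟨k, hk⟩ := hx.exists_le_dist (R (K + 1))
  -- If τ were this small, the first N(K+1)+1 powers of g would translate by less than 1, too many
  -- elements for acylindricity.
  have hd : ∀ i ≤ N (K + 1), dist x (g ^ i • x) ≤ K + 1 := by
    intro i hi
    have h1 := hx.2 i
    have h2 : (i : ℝ) * translationLength S g ≤ N (K + 1) * translationLength S g :=
      mul_le_mul_of_nonneg_right (by exact_mod_cast hi) hx.1.le
    linarith
  obtain ⟨i, j, hij, -, he⟩ := h.exists_eq_of_dist_le (by linarith) hk (fun i => g ^ i) hd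
    (fun i hi => by
      rw [dist_smul_comm_smul ((Commute.refl g).pow_pow i k)]
      exact hd i hi)
  have := injective_pow_iff_not_isOfFinOrder.2 (not_isOfFinOrder_of_isLoxodromic S hx.1) he
  omega

/-- In an acylindrical action, an element that inverts a loxodromic element has finite order. -/
theorem AcylindricalWith.isOfFinOrder_of_inverts {R : ℝ → ℝ} {N : ℝ → ℕ}
    (h : AcylindricalWith Γ S R N) {Δ : ℝ} (hΔ : FourPoint Δ S) {K : ℝ} {G t : Γ} {x : S}
    (hx : IsAxisPoint K G x) (ht : t * G = G⁻¹ * t) : IsOfFinOrder t := by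
  have hK := hx.nonneg
  have hΔ0 := hΔ.nonneg
  have hsc : SemiconjBy t G G⁻¹ := ht
  have hc2 : Commute (t ^ 2) G := by
    have := hsc.inv_right
    rw [inv_inv] at this
    rw [pow_two]
    exact this.mul_left hsc
  have hcn : ∀ n : ℕ, Commute ((t ^ 2) ^ n) G := fun n => hc2.pow_left n
  set r := dist x (t • x) + 3 * K + 2 * Δ + 1 with hr
  have hr0 : 0 < r := by positivity
  -- H = t²ⁿ commutes with G and shifts its axis by some amount. As t flips the axis and commutes
  -- with H, Hx is almost equidistant from G⁻ᵏx and Gᵏx; being almost between them, it is near x.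
  have hd : ∀ n : ℕ, dist x ((t ^ 2) ^ n • x) ≤ r := by
    intro n
    set H := (t ^ 2) ^ n with hH
    have htH : Commute t H := ((Commute.refl t).pow_right 2).pow_right n
    obtain ⟨k, hk⟩ := hx.exists_le_dist (2 * K + 4 * dist x (H • x) + Δ + 1)
    have hD : 0 ≤ dist x (H • x) := dist_nonneg
    have h3 := hx.almost_between hΔ (hcn n) (k := k) (by linarith)
    have h4 := dist_inv_smul_self (G ^ k) x
    have h5 := dist_comm x (G ^ k • x)
    have h6 := dist_triangle ((G ^ k)⁻¹ • x) x (G ^ k • x)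
    have e1 : t • (G ^ k)⁻¹ • x = G ^ k • t • x := by
      have h7 := hsc.inv_right.pow_right k
      rw [inv_inv, inv_pow] at h7
      rw [smul_smul, h7.eq, mul_smul]
    have e2 : dist ((G ^ k)⁻¹ • x) (H • x) = dist (G ^ k • t • x) (H • t • x) := by
      rw [← dist_smul t, e1, smul_smul t H, htH.eq, mul_smul]
    have e3 : dist (G ^ k • x) (G ^ k • t • x) = dist x (t • x) := dist_smul _ _ _
    have e4 : dist (H • x) (H • t • x) = dist x (t • x) := dist_smul _ _ _
    have t1 := dist_triangle4 (G ^ k • x) (G ^ k • t • x) (H • t • x) (H • x)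
    have t2 := dist_triangle4 (G ^ k • t • x) (G ^ k • x) (H • x) (H • t • x)
    have c1 := dist_comm (H • t • x) (H • x)
    have c2 := dist_comm (G ^ k • t • x) (G ^ k • x)
    have c3 := dist_comm (H • x) (G ^ k • x)
    rcases hx.dist_le_or hΔ k (H • x) with h4 | h4 <;> linarith
  obtain ⟨k, hk⟩ := hx.exists_le_dist (R r)
  obtain ⟨i, j, hij, -, he⟩ := h.exists_eq_of_dist_le hr0 hk (fun i => (t ^ 2) ^ i)
    (fun i _ => hd i)
    (fun i _ => by rw [dist_smul_comm_smul ((hcn i).pow_right k)]; exact hd i)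
  have : IsOfFinOrder (t ^ 2) := by
    by_contra hcon
    have := injective_pow_iff_not_isOfFinOrder.2 hcon he
    omega
  exact this.of_pow (by norm_num)

end Acylindrical

/-! ### Stability of quasi-geodesics. -/

section Morse

variable {S : Type*} [MetricSpace S]

/-- A unit-speed path of length at most `2 ^ N` passes close to every point that is almost
between its endpoints. -/
theorem FourPoint.exists_dist_le_of_sub_le_two_pow {Δ : ℝ} (hΔ : FourPoint Δ S) {f : ℝ → S}
    (x : S) (N : ℕ) : ∀ {a b C : ℝ}, a ≤ b → b - a ≤ 2 ^ N →
      (∀ s ∈ Icc a b, ∀ t ∈ Icc a b, dist (f s) (f t) ≤ |s - t|) →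
      dist (f a) x + dist x (f b) ≤ dist (f a) (f b) + C →
      ∃ t ∈ Icc a b, 2 * dist x (f t) ≤ C + N * Δ + 2 := by
  induction N with
  | zero =>
    intro a b C hab hlen hlip hC
    refine ⟨a, ⟨le_rfl, hab⟩, ?_⟩
    have h1 := hlip a ⟨le_rfl, hab⟩ b ⟨hab, le_rfl⟩
    rw [abs_sub_comm, abs_of_nonneg (by linarith)] at h1
    have h2 := dist_triangle (f a) (f b) x
    simp only [pow_zero] at hlen
    push_cast
    linarith [dist_comm x (f a), dist_comm (f b) x]
  | succ N ih =>
    intro a b C hab hlen hlip hC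
    set m := (a + b) / 2 with hm
    have ham : a ≤ m := by linarith
    have hmb : m ≤ b := by linarith
    rw [pow_succ] at hlen
    -- Bisection: x stays almost between the endpoints of one of the halves, with the excess
    -- increased by Δ. After N halvings the interval has length at most 1.
    rcases hΔ.or (f a) (f b) x (f m) with h | h
    · obtain ⟨t, ht, h1⟩ := ih (a := m) (b := b) (C := C + Δ) hmb (by linarith)
        (fun s hs t ht => hlip s ⟨ham.trans hs.1, hs.2⟩ t ⟨ham.trans ht.1, ht.2⟩)
        (by linarith [dist_comm (f m) x, dist_comm (f b) (f m)])
      refine ⟨t, ⟨ham.trans ht.1, ht.2⟩, ?_⟩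
      push_cast
      linarith
    · obtain ⟨t, ht, h1⟩ := ih (a := a) (b := m) (C := C + Δ) ham (by linarith)
        (fun s hs t ht => hlip s ⟨hs.1, hs.2.trans hmb⟩ t ⟨ht.1, ht.2.trans hmb⟩)
        (by linarith [dist_comm (f b) x])
      refine ⟨t, ⟨ht.1, ht.2.trans hmb⟩, ?_⟩
      push_cast
      linarith

/-- For N ≈ D/(Δ+1), 2ᴺ beats a path length linear in D while the bisection error NΔ stays below 2D;
this is the contradiction that bounds D in the Morse lemma. -/
theorem exists_linear_le_two_pow (Δ k : ℝ) (hΔ : 0 ≤ Δ) : ∃ D₀ : ℝ, Δ ≤ D₀ ∧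
    ∀ D, D₀ < D → ∃ N : ℕ, 12 * D + k ≤ 2 ^ N ∧ (N + 2) * Δ + 2 < 2 * D := by
  have h1 : Tendsto (fun n : ℕ => (n : ℝ) ^ 1 / 2 ^ n) atTop (𝓝 0) :=
    tendsto_pow_const_div_const_pow_of_one_lt 1 (by norm_num)
  have h2 : ∀ᶠ n : ℕ in atTop, (n : ℝ) ^ 1 / 2 ^ n < 1 / (24 * (Δ + 1)) :=
    h1.eventually_lt_const (by positivity)
  have h3 : ∀ᶠ n : ℕ in atTop, 2 * (12 * (Δ + 1) + k) ≤ (2 : ℝ) ^ n :=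
    (tendsto_pow_atTop_atTop_of_one_lt (by norm_num)).eventually_ge_atTop _
  obtain ⟨N₀, hN₀⟩ := eventually_atTop.1 (h2.and h3)
  refine ⟨max (2 * Δ + 2) (N₀ * (Δ + 1)), le_trans (by linarith) (le_max_left _ _), ?_⟩
  intro D hD
  have hD1 := (le_max_left _ _).trans_lt hD
  have hD2 := (le_max_right _ _).trans_lt hD
  have hΔ1 : 0 < Δ + 1 := by linarith
  refine ⟨⌊D / (Δ + 1)⌋₊, ?_, ?_⟩
  · obtain ⟨h4, h5⟩ := hN₀ ⌊D / (Δ + 1)⌋₊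
      (Nat.le_floor (by rw [le_div_iff₀ hΔ1]; exact hD2.le))
    have h6 := Nat.lt_floor_add_one (D / (Δ + 1))
    rw [div_lt_iff₀ hΔ1] at h6
    rw [pow_one, div_lt_div_iff₀ (by positivity) (by positivity)] at h4
    nlinarith
  · have h6 := Nat.floor_le (show 0 ≤ D / (Δ + 1) by apply div_nonneg <;> linarith)
    rw [le_div_iff₀ hΔ1] at h6
    have : (0 : ℝ) ≤ (⌊D / (Δ + 1)⌋₊ : ℝ) := Nat.cast_nonneg _
    linarith

/-- Take the point x of the geodesic farthest from the path, at distance D. Moving 2D to either side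
(or to an endpoint) and then at most D to the path cuts out a piece with endpoints at most 6D apart,
hence of length at most 12D + k, with x almost between them. Bisection finds a point of it nearer to
x than D unless D ≤ D₀. -/
theorem exists_geodesic_near_quasigeodesic.{v₁} (Δ k : ℝ) (hΔ : 0 ≤ Δ) : ∃ D₀ : ℝ, 0 ≤ D₀ ∧
    ∀ (S : Type v₁) [MetricSpace S], FourPoint Δ S → ∀ (f : ℝ → S) (a b : ℝ), a ≤ b →
      (∀ s ∈ Icc a b, ∀ t ∈ Icc a b, dist (f s) (f t) ≤ |s - t|) →
      (∀ s ∈ Icc a b, ∀ t ∈ Icc a b, |s - t| ≤ 2 * dist (f s) (f t) + k) →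
      ∀ p : ArcPath S, p.IsGeodesic → p.Joins (f a) (f b) →
      ∀ t ∈ Icc 0 p.len, ∃ s ∈ Icc a b, dist (p.toFun t) (f s) ≤ D₀ := by
  obtain ⟨D₀, hD₀, hN⟩ := exists_linear_le_two_pow Δ k hΔ
  refine ⟨D₀, hΔ.trans hD₀, ?_⟩
  intro S _ hS f a b hab hlip hqg p hp hj
  have hcont := continuousOn_of_dist_le_abs_sub hlip
  have hcomp : IsCompact (f '' Icc a b) := isCompact_Icc.image_of_continuousOn hcont
  have hne : (f '' Icc a b).Nonempty := ⟨f a, a, ⟨le_rfl, hab⟩, rfl⟩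
  have hφ : ContinuousOn (fun t => Metric.infDist (p.toFun t) (f '' Icc a b)) (Icc 0 p.len) :=
    (Metric.continuous_infDist_pt _).comp_continuousOn p.continuousOn
  obtain ⟨r, hr, hmax⟩ := isCompact_Icc.exists_isMaxOn ⟨0, p.zero_mem⟩ hφ
  set D := Metric.infDist (p.toFun r) (f '' Icc a b) with hD
  have near : ∀ t ∈ Icc 0 p.len, ∃ s ∈ Icc a b, dist (p.toFun t) (f s) ≤ D := by
    intro t ht
    obtain ⟨_, ⟨s, hs, rfl⟩, h⟩ := hcomp.exists_infDist_eq_dist hne (p.toFun t)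
    exact ⟨s, hs, h ▸ hmax ht⟩
  have far : ∀ s ∈ Icc a b, D ≤ dist (p.toFun r) (f s) := fun s hs =>
    Metric.infDist_le_dist_of_mem ⟨s, hs, rfl⟩
  suffices D ≤ D₀ by
    intro t ht
    obtain ⟨s, hs, h⟩ := near t ht
    exact ⟨s, hs, h.trans this⟩
  by_contra! hlt
  obtain ⟨N, hN1, hN2⟩ := hN D hlt
  have hD0 : 0 ≤ D := Metric.infDist_nonneg
  have left : ∃ u ∈ Icc 0 p.len, ∃ s ∈ Icc a b, u ≤ r ∧ r - u ≤ 2 * D ∧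
      dist (p.toFun u) (f s) ≤ D ∧
      (dist (p.toFun u) (f s) + D ≤ dist (p.toFun u) (p.toFun r) ∨ p.toFun u = f s) := by
    rcases le_total (r - 2 * D) 0 with h | h
    · exact ⟨0, p.zero_mem, a, ⟨le_rfl, hab⟩, hr.1, by linarith, by rw [hj.1]; simpa using hD0,
        Or.inr hj.1⟩
    · have hu : r - 2 * D ∈ Icc 0 p.len := ⟨h, by linarith [hr.2]⟩
      obtain ⟨s, hs, h1⟩ := near _ hu
      refine ⟨_, hu, s, hs, by linarith, by linarith, h1, Or.inl ?_⟩
      rw [hp _ hu _ hr, abs_sub_comm, abs_of_nonneg (by linarith)]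
      linarith
  have right : ∃ u ∈ Icc 0 p.len, ∃ s ∈ Icc a b, r ≤ u ∧ u - r ≤ 2 * D ∧
      dist (p.toFun u) (f s) ≤ D ∧
      (dist (p.toFun u) (f s) + D ≤ dist (p.toFun u) (p.toFun r) ∨ p.toFun u = f s) := by
    rcases le_total p.len (r + 2 * D) with h | h
    · exact ⟨p.len, p.len_mem, b, ⟨hab, le_rfl⟩, hr.2, by linarith,
        by rw [hj.2]; simpa using hD0, Or.inr hj.2⟩
    · have hu : r + 2 * D ∈ Icc 0 p.len := ⟨by linarith [hr.1], h⟩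
      obtain ⟨s, hs, h1⟩ := near _ hu
      refine ⟨_, hu, s, hs, by linarith, by linarith, h1, Or.inl ?_⟩
      rw [hp _ hu _ hr, abs_of_nonneg (by linarith)]
      linarith
  obtain ⟨u, hu, s, hs, hur, hur2, hus, hus2⟩ := left
  obtain ⟨v, hv, t, ht, hvr, hvr2, hvt, hvt2⟩ := right
  have d1 := hp u hu r hr
  have d2 := hp v hv r hr
  have d3 := hp u hu v hv
  rw [abs_sub_comm, abs_of_nonneg (by linarith)] at d1 d3
  rw [abs_of_nonneg (by linarith)] at d2
  have fs := far s hs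
  have ft := far t ht
  set x := p.toFun r
  set y := p.toFun u
  set z := p.toFun v
  have g1 : dist x z + dist x (f s) ≤ dist z (f s) + Δ := by
    rcases hus2 with h | h
    · rcases hS.or y z x (f s) with h1 | h1
      · linarith [dist_comm z x]
      · linarith [dist_comm z x]
    · rw [← h]
      linarith [dist_comm z x, dist_comm x y, dist_comm z y]
  have g2 : dist x (f s) + dist x (f t) ≤ dist (f s) (f t) + 2 * Δ := by
    rcases hvt2 with h | h
    · rcases hS.or z (f s) x (f t) with h1 | h1
      · linarith [dist_comm z x, dist_comm x (f s), dist_comm (f s) (f t)]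
      · linarith [dist_comm z x, dist_comm x (f s), dist_comm (f s) (f t)]
    · rw [← h]
      linarith [dist_comm z (f s)]
  have g3 : |s - t| ≤ 2 ^ N := by
    have h1 := hqg s hs t ht
    have h2 := dist_triangle4 (f s) y z (f t)
    linarith [dist_comm (f s) y]
  have : ∃ q ∈ Icc a b, 2 * dist x (f q) ≤ 2 * Δ + N * Δ + 2 := by
    rcases le_total s t with hst | hst
    · rw [abs_sub_comm, abs_of_nonneg (by linarith)] at g3
      obtain ⟨q, hq, h⟩ := hS.exists_dist_le_of_sub_le_two_pow (f := f) x N hst g3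
        (fun i hi j hj => hlip i ⟨hs.1.trans hi.1, hi.2.trans ht.2⟩ j
          ⟨hs.1.trans hj.1, hj.2.trans ht.2⟩) (C := 2 * Δ) (by linarith [dist_comm x (f s)])
      exact ⟨q, ⟨hs.1.trans hq.1, hq.2.trans ht.2⟩, h⟩
    · rw [abs_of_nonneg (by linarith)] at g3
      obtain ⟨q, hq, h⟩ := hS.exists_dist_le_of_sub_le_two_pow (f := f) x N hst g3
        (fun i hi j hj => hlip i ⟨ht.1.trans hi.1, hi.2.trans hs.2⟩ j
          ⟨ht.1.trans hj.1, hj.2.trans hs.2⟩) (C := 2 * Δ)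
          (by linarith [dist_comm x (f t), dist_comm (f s) (f t)])
      exact ⟨q, ⟨ht.1.trans hq.1, hq.2.trans hs.2⟩, h⟩
  obtain ⟨q, hq, h⟩ := this
  have := far q hq
  linarith

/-- Stability of quasi-geodesics: points almost between the endpoints are close to the
quasi-geodesic, and the points of the quasi-geodesic are almost between its endpoints. -/
theorem exists_quasigeodesic_stability.{v₁} (δ C k : ℝ) (hδ : 0 < δ) (hC : 0 ≤ C) :
    ∃ D₁ : ℝ, 0 ≤ D₁ ∧
    ∀ (S : Type v₁) [MetricSpace S], IsHyperbolic δ S → ∀ (f : ℝ → S) (a b : ℝ), a ≤ b →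
      (∀ s ∈ Icc a b, ∀ t ∈ Icc a b, dist (f s) (f t) ≤ |s - t|) →
      (∀ s ∈ Icc a b, ∀ t ∈ Icc a b, |s - t| ≤ 2 * dist (f s) (f t) + k) →
      (∀ q, dist (f a) q + dist q (f b) ≤ dist (f a) (f b) + C →
        ∃ s ∈ Icc a b, dist q (f s) ≤ D₁) ∧
      ∀ s ∈ Icc a b, dist (f a) (f s) + dist (f s) (f b) ≤ dist (f a) (f b) + D₁ := by
  obtain ⟨D₀, hD₀, hM⟩ := exists_geodesic_near_quasigeodesic.{v₁} (8 * δ) k (by linarith)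
  refine ⟨max (D₀ + C + 8 * δ) (2 * (5 * D₀ + k)),
    (show 0 ≤ D₀ + C + 8 * δ by positivity).trans (le_max_left _ _), ?_⟩
  intro S _ hS f a b hab hlip hqg
  have h4 := hS.fourPoint hδ
  obtain ⟨p, hp, hj⟩ := hS.geodesic (f a) (f b)
  have hnear := hM S h4 f a b hab hlip hqg p hp hj
  constructor
  · intro q hq
    obtain ⟨t, ht, h1⟩ := h4.exists_dist_le_of_almost_between hp hj hC hq
    obtain ⟨s, hs, h2⟩ := hnear t ht
    refine ⟨s, hs, le_trans ?_ (le_max_left _ _)⟩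
    linarith [dist_triangle q (p.toFun t) (f s)]
  · intro s hs
    have hcont := continuousOn_of_dist_le_abs_sub hlip
    have hc1 : IsCompact (f '' Icc a s) :=
      isCompact_Icc.image_of_continuousOn (hcont.mono (Icc_subset_Icc_right hs.2))
    have hc2 : IsCompact (f '' Icc s b) :=
      isCompact_Icc.image_of_continuousOn (hcont.mono (Icc_subset_Icc_left hs.1))
    have hI : IsPreconnected p.image := isPreconnected_Icc.image _ p.continuousOn
    have hclosed : ∀ A : Set S, IsClosed {q | Metric.infDist q A ≤ D₀} := fun A =>
      isClosed_le (Metric.continuous_infDist_pt A) continuous_const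
    -- By connectedness some point of the geodesic is within D₀ of the path both before and after
    -- time s. These two times differ by at most 4D₀ + k, so f s is within 5D₀ + k of the geodesic.
    have := isPreconnected_closed_iff.1 hI _ _ (hclosed (f '' Icc a s)) (hclosed (f '' Icc s b))
      (by
        rintro _ ⟨t, ht, rfl⟩
        obtain ⟨u, hu, h⟩ := hnear t ht
        rcases le_total u s with hus | hus
        · exact Or.inl ((Metric.infDist_le_dist_of_mem (mem_image_of_mem f
            (show u ∈ Icc a s from ⟨hu.1, hus⟩))).trans h)
        · exact Or.inr ((Metric.infDist_le_dist_of_mem (mem_image_of_mem f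
            (show u ∈ Icc s b from ⟨hus, hu.2⟩))).trans h))
      ⟨f a, ⟨0, p.zero_mem, hj.1⟩, by
        simp only [mem_ofPred_eq]
        rw [Metric.infDist_zero_of_mem (mem_image_of_mem f (left_mem_Icc.2 hs.1))]; exact hD₀⟩
      ⟨f b, ⟨p.len, p.len_mem, hj.2⟩, by
        simp only [mem_ofPred_eq]
        rw [Metric.infDist_zero_of_mem (mem_image_of_mem f (right_mem_Icc.2 hs.2))]; exact hD₀⟩
    obtain ⟨_, ⟨t, ht, rfl⟩, h1, h2⟩ := this
    obtain ⟨_, ⟨u, hu, rfl⟩, e1⟩ := hc1.exists_infDist_eq_dist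
      ⟨f a, a, ⟨le_rfl, hs.1⟩, rfl⟩ (p.toFun t)
    obtain ⟨_, ⟨v, hv, rfl⟩, e2⟩ := hc2.exists_infDist_eq_dist
      ⟨f b, b, ⟨hs.2, le_rfl⟩, rfl⟩ (p.toFun t)
    simp only [mem_ofPred_eq] at h1 h2
    rw [e1] at h1
    rw [e2] at h2
    have hu' : u ∈ Icc a b := ⟨hu.1, hu.2.trans hs.2⟩
    have hv' : v ∈ Icc a b := ⟨hs.1.trans hv.1, hv.2⟩
    have q1 := hqg u hu' v hv'
    have q2 := hlip u hu' s hs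
    rw [abs_sub_comm, abs_of_nonneg (by linarith [hu.2, hv.1])] at q1
    rw [abs_sub_comm, abs_of_nonneg (by linarith [hu.2])] at q2
    have q3 := dist_triangle (f u) (p.toFun t) (f v)
    have q4 := dist_triangle (p.toFun t) (f u) (f s)
    have q5 := hp.dist_left hj ht
    have q6 := hp.dist_right hj ht
    have q7 := hp.len_eq hj
    have q8 := dist_triangle (f a) (p.toFun t) (f s)
    have q9 := dist_triangle (f s) (p.toFun t) (f b)
    have := le_max_right (D₀ + C + 8 * δ) (2 * (5 * D₀ + k))
    linarith [dist_comm (f u) (p.toFun t), dist_comm (f s) (p.toFun t), hv.1]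

end Morse

/-! ### Restriction, concatenation and translation of arc-length paths. -/

section PathOperations

variable {S : Type*} [MetricSpace S]

theorem hasUnitSpeedOn_Icc_mono {f : ℝ → S} {a b a' b' : ℝ} (h : HasUnitSpeedOn f (Icc a b))
    (ha : a ≤ a') (hb : b' ≤ b) : HasUnitSpeedOn f (Icc a' b') := by
  intro x hx y hy
  have h1 : Icc a' b' ∩ Icc x y = Icc a b ∩ Icc x y := by
    rw [inter_eq_right.2 (Icc_subset_Icc hx.1 hy.2),
      inter_eq_right.2 (Icc_subset_Icc (ha.trans hx.1) (hy.2.trans hb))]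
  rw [h1]
  exact h ⟨ha.trans hx.1, hx.2.trans hb⟩ ⟨ha.trans hy.1, hy.2.trans hb⟩

theorem hasUnitSpeedOn_Icc_shift {f : ℝ → S} {a b : ℝ} (c : ℝ) (h : HasUnitSpeedOn f (Icc a b)) :
    HasUnitSpeedOn (fun u => f (c + u)) (Icc (a - c) (b - c)) := by
  intro x hx y hy
  have h1 := h (x := c + x) ⟨by linarith [hx.1], by linarith [hx.2]⟩
    (y := c + y) ⟨by linarith [hy.1], by linarith [hy.2]⟩
  have h2 := eVariationOn.comp_eq_of_monotoneOn f (t := Icc (a - c) (b - c) ∩ Icc x y)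
    (fun u => c + u) (fun u _ v _ huv => by simpa using huv)
  have h3 : (fun u => c + u) '' (Icc (a - c) (b - c) ∩ Icc x y)
      = Icc a b ∩ Icc (c + x) (c + y) := by
    rw [image_inter (add_right_injective c), image_const_add_Icc, image_const_add_Icc,
      add_sub_cancel, add_sub_cancel]
  rw [h3, h1, add_sub_add_left_eq_sub] at h2
  exact h2

theorem hasUnitSpeedOn_congr {f f' : ℝ → S} {A : Set ℝ} (h : HasUnitSpeedOn f A)
    (he : EqOn f f' A) : HasUnitSpeedOn f' A := by
  intro x hx y hy
  rw [← h hx hy]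
  exact eVariationOn.eq_of_eqOn fun u hu => (he hu.1).symm

namespace ArcPath

/-- The restriction of a path to a subinterval. -/
def sub (p : ArcPath S) (s t : ℝ) (hs : 0 ≤ s) (hst : s ≤ t) (ht : t ≤ p.len) : ArcPath S where
  len := t - s
  toFun := fun u => p.toFun (s + u)
  len_nonneg := by linarith
  unit_speed := by
    have := hasUnitSpeedOn_Icc_shift s (hasUnitSpeedOn_Icc_mono p.unit_speed hs ht)
    rwa [sub_self] at this

theorem sub_joins (p : ArcPath S) {s t : ℝ} (hs : 0 ≤ s) (hst : s ≤ t) (ht : t ≤ p.len) :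
    (p.sub s t hs hst ht).Joins (p.toFun s) (p.toFun t) := by
  constructor <;> simp [sub]

/-- Concatenation of paths. -/
def trans (p q : ArcPath S) (h : p.toFun p.len = q.toFun 0) : ArcPath S where
  len := p.len + q.len
  toFun := fun u => if u ≤ p.len then p.toFun u else q.toFun (u - p.len)
  len_nonneg := add_nonneg p.len_nonneg q.len_nonneg
  unit_speed := by
    refine HasUnitSpeedOn.Icc_Icc (y := p.len) ?_ ?_
    · exact hasUnitSpeedOn_congr p.unit_speed fun u hu => by simp [hu.2]
    · have h1 := hasUnitSpeedOn_Icc_shift (-p.len) q.unit_speed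
      rw [sub_neg_eq_add, sub_neg_eq_add, zero_add, add_comm q.len] at h1
      refine hasUnitSpeedOn_congr h1 fun u hu => ?_
      rcases hu.1.eq_or_lt with rfl | hlt
      · simp [h]
      · simp only [not_le.2 hlt, if_false]
        congr 1; ring

theorem trans_toFun_left {p q : ArcPath S} (h : p.toFun p.len = q.toFun 0) {u : ℝ}
    (hu : u ≤ p.len) : (p.trans q h).toFun u = p.toFun u := by
  simp [trans, hu]

theorem trans_toFun_right {p q : ArcPath S} (h : p.toFun p.len = q.toFun 0) {u : ℝ}
    (hu : 0 ≤ u) : (p.trans q h).toFun (p.len + u) = q.toFun u := by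
  rcases hu.eq_or_lt with rfl | hlt
  · simp [trans, h]
  · simp [trans, hlt]

theorem Joins.trans {p q : ArcPath S} {x y z : S} (hp : p.Joins x y) (hq : q.Joins y z) :
    (p.trans q (hp.2.trans hq.1.symm)).Joins x z :=
  ⟨by rw [trans_toFun_left _ p.len_nonneg, hp.1],
    by rw [show (p.trans q _).len = p.len + q.len from rfl, trans_toFun_right _ q.len_nonneg, hq.2]⟩

theorem reverse_reverse (p : ArcPath S) : p.reverse.reverse = p := by
  cases p
  simp [reverse]

/-- The image of a path under an isometry. -/
def smul {Γ : Type*} [Group Γ] [MulAction Γ S] [IsIsometricSMul Γ S] (g : Γ) (p : ArcPath S) :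
    ArcPath S where
  len := p.len
  toFun := fun u => g • p.toFun u
  len_nonneg := p.len_nonneg
  unit_speed := by
    intro x hx y hy
    rw [← p.unit_speed hx hy]
    simp only [eVariationOn, (isometry_smul S g).edist_eq]

theorem Joins.smul {Γ : Type*} [Group Γ] [MulAction Γ S] [IsIsometricSMul Γ S] {p : ArcPath S}
    {x y : S} (h : p.Joins x y) (g : Γ) : (p.smul g).Joins (g • x) (g • y) :=
  ⟨by simp [ArcPath.smul, h.1], by simp [ArcPath.smul, h.2]⟩

end ArcPath

end PathOperations

/-! ### Counting non-overlapping copies of w. -/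

section CopyCount

variable {Γ : Type*} [Group Γ] {S : Type*} [MetricSpace S] [MulAction Γ S]

/-- `HasCopies` with an arbitrary finite index type. -/
theorem hasCopies_card {w α : ArcPath S} {ι : Type*} [Fintype ι] (s : ι → ℝ) (g : ι → Γ)
    (h1 : ∀ i, 0 ≤ s i ∧ s i + w.len ≤ α.len)
    (h2 : ∀ i, ∀ t ∈ Icc 0 w.len, α.toFun (s i + t) = g i • w.toFun t)
    (h3 : Pairwise fun i j => w.len ≤ |s i - s j|) : HasCopies Γ w α (Fintype.card ι) := by
  let e := (Fintype.equivFin ι).symm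
  exact ⟨fun i => s (e i), fun i => g (e i), fun i => h1 _, fun i => h2 _,
    fun i j hij => h3 (e.injective.ne hij)⟩

/-- Starting times at least |w| apart have distinct values of ⌊s/|w|⌋, all below ⌊|α|/|w|⌋. -/
theorem HasCopies.mul_len_le {w α : ArcPath S} (hw : 0 < w.len) {n : ℕ}
    (h : HasCopies Γ w α n) : n * w.len ≤ α.len := by
  obtain ⟨s, g, h1, -, h3⟩ := h
  have hinj : Function.Injective fun i => ⌊s i / w.len⌋₊ := by
    intro i j hij
    by_contra hne
    have h4 := h3 hne
    have hi := div_nonneg (h1 i).1 hw.le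
    have hj := div_nonneg (h1 j).1 hw.le
    simp only at hij
    have a1 := Nat.floor_le hi
    have a2 := Nat.lt_floor_add_one (s i / w.len)
    have a3 := Nat.floor_le hj
    have a4 := Nat.lt_floor_add_one (s j / w.len)
    rw [hij] at a1 a2
    have h5 : |s i / w.len - s j / w.len| < 1 := by
      rw [abs_lt]; constructor <;> linarith
    rw [← sub_div, abs_div, abs_of_pos hw, div_lt_one hw] at h5
    linarith
  have hmem : ∀ i ∈ (Finset.univ : Finset (Fin n)),
      ⌊s i / w.len⌋₊ ∈ Finset.range ⌊α.len / w.len⌋₊ := by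
    intro i _
    rw [Finset.mem_range]
    refine Nat.lt_of_succ_le ?_
    rw [Nat.succ_eq_add_one, ← Nat.floor_add_one (div_nonneg (h1 i).1 hw.le)]
    refine Nat.floor_mono ?_
    rw [div_add_one hw.ne']
    exact div_le_div_of_nonneg_right (h1 i).2 hw.le
  have hcard := Finset.card_le_card_of_injOn _ hmem hinj.injOn
  rw [Finset.card_univ, Fintype.card_fin, Finset.card_range] at hcard
  have : (n : ℝ) ≤ α.len / w.len :=
    (Nat.cast_le.2 hcard).trans (Nat.floor_le (div_nonneg α.len_nonneg hw.le))
  rwa [le_div_iff₀ hw] at this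

/-- Makes the supremum in `copyCount` an attained maximum; in ℕ an unbounded set would have supremum
0. -/
theorem bddAbove_hasCopies {w : ArcPath S} (hw : 0 < w.len) (α : ArcPath S) :
    BddAbove {n | HasCopies Γ w α n} := by
  refine ⟨⌊α.len / w.len⌋₊, fun n hn => Nat.le_floor ?_⟩
  rw [le_div_iff₀ hw]
  exact hn.mul_len_le hw

theorem HasCopies.le_copyCount {w α : ArcPath S} (hw : 0 < w.len) {n : ℕ}
    (h : HasCopies Γ w α n) : n ≤ copyCount Γ w α :=
  le_csSup (bddAbove_hasCopies hw α) h

theorem hasCopies_zero (w α : ArcPath S) : HasCopies Γ w α 0 :=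
  ⟨Fin.elim0, Fin.elim0, fun i => i.elim0, fun i => i.elim0, fun i => i.elim0⟩

theorem hasCopies_copyCount {w : ArcPath S} (hw : 0 < w.len) (α : ArcPath S) :
    HasCopies Γ w α (copyCount Γ w α) :=
  Nat.sSup_mem ⟨0, hasCopies_zero w α⟩ (bddAbove_hasCopies hw α)

theorem copyCount_mul_len_le {w : ArcPath S} (hw : 0 < w.len) (α : ArcPath S) :
    copyCount Γ w α * w.len ≤ α.len :=
  (hasCopies_copyCount hw α).mul_len_le hw

theorem one_le_copyCount_self {w : ArcPath S} (hw : 0 < w.len) : 1 ≤ copyCount Γ w w := by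
  refine HasCopies.le_copyCount hw ⟨fun _ => 0, fun _ => 1, ?_, ?_, ?_⟩
  · simp
  · simp
  · intro i j hij
    exact absurd (Subsingleton.elim i j) hij

theorem copyCount_add_le_trans {w : ArcPath S} (hw : 0 < w.len) {p q : ArcPath S}
    (h : p.toFun p.len = q.toFun 0) :
    copyCount Γ w p + copyCount Γ w q ≤ copyCount Γ w (p.trans q h) := by
  obtain ⟨s, g, a1, a2, a3⟩ := hasCopies_copyCount (Γ := Γ) hw p
  obtain ⟨s', g', b1, b2, b3⟩ := hasCopies_copyCount (Γ := Γ) hw q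
  have := (hasCopies_card (Γ := Γ) (w := w) (α := p.trans q h)
    (Sum.elim s fun i => p.len + s' i) (Sum.elim g g') ?_ ?_ ?_).le_copyCount hw
  · simpa using this
  · have hlen : (p.trans q h).len = p.len + q.len := rfl
    have := p.len_nonneg
    have := q.len_nonneg
    rintro (i | i)
    · have := a1 i
      simp only [Sum.elim_inl, hlen]
      constructor <;> linarith
    · have := b1 i
      simp only [Sum.elim_inr, hlen]
      constructor <;> linarith
  · rintro (i | i) t ht
    · simp only [Sum.elim_inl]
      rw [ArcPath.trans_toFun_left _ (by linarith [(a1 i).2, ht.2]), a2 i t ht]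
    · simp only [Sum.elim_inr]
      rw [add_assoc, ArcPath.trans_toFun_right _ (by linarith [(b1 i).1, ht.1]), b2 i t ht]
  · rintro (i | i) (j | j) hij
    · exact a3 (fun h => hij (by rw [h]))
    · simp only [Sum.elim_inl, Sum.elim_inr]
      rw [abs_sub_comm]
      exact le_trans (by linarith [(a1 i).2, (b1 j).1]) (le_abs_self _)
    · simp only [Sum.elim_inl, Sum.elim_inr]
      exact le_trans (by linarith [(a1 j).2, (b1 i).1]) (le_abs_self _)
    · simp only [Sum.elim_inr, add_sub_add_left_eq_sub]
      exact b3 (fun h => hij (by rw [h]))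

/-- Of the disjoint copies, at most one straddles time t; the others survive in one of the two
pieces. -/
theorem copyCount_le_sub_add_sub {w : ArcPath S} (hw : 0 < w.len) (α : ArcPath S) {t : ℝ}
    (h0 : 0 ≤ t) (ht : t ≤ α.len) :
    copyCount Γ w α ≤ copyCount Γ w (α.sub 0 t le_rfl h0 ht)
      + copyCount Γ w (α.sub t α.len h0 ht le_rfl) + 1 := by
  classical
  have hcopies := hasCopies_copyCount (Γ := Γ) hw α
  generalize copyCount Γ w α = n at hcopies ⊢
  obtain ⟨s, g, a1, a2, a3⟩ := hcopies
  let A : Finset (Fin n) := Finset.univ.filter fun i => s i + w.len ≤ t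
  let B : Finset (Fin n) := Finset.univ.filter fun i => t ≤ s i
  let C : Finset (Fin n) := Finset.univ.filter fun i => s i < t ∧ t < s i + w.len
  have hA : A.card ≤ copyCount Γ w (α.sub 0 t le_rfl h0 ht) := by
    have := (hasCopies_card (Γ := Γ) (w := w) (α := α.sub 0 t le_rfl h0 ht) (ι := A)
      (fun i => s i) (fun i => g i) ?_ ?_ ?_).le_copyCount hw
    · simpa using this
    · rintro ⟨i, hi⟩
      have hi' : s i + w.len ≤ t := (Finset.mem_filter.1 hi).2
      exact ⟨(a1 i).1, by simpa [ArcPath.sub] using hi'⟩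
    · rintro ⟨i, hi⟩ u hu
      simp only [ArcPath.sub, zero_add]
      exact a2 i u hu
    · intro i j hij
      exact a3 (fun h => hij (Subtype.ext h))
  have hB : B.card ≤ copyCount Γ w (α.sub t α.len h0 ht le_rfl) := by
    have := (hasCopies_card (Γ := Γ) (w := w) (α := α.sub t α.len h0 ht le_rfl) (ι := B)
      (fun i => s i - t) (fun i => g i) ?_ ?_ ?_).le_copyCount hw
    · simpa using this
    · rintro ⟨i, hi⟩
      have hi' : t ≤ s i := (Finset.mem_filter.1 hi).2
      simp only [ArcPath.sub]
      exact ⟨by linarith, by linarith [(a1 i).2]⟩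
    · rintro ⟨i, hi⟩ u hu
      simp only [ArcPath.sub]
      rw [← a2 i u hu]
      congr 1; ring
    · intro i j hij
      simp only [sub_sub_sub_cancel_right]
      exact a3 (fun h => hij (Subtype.ext h))
  have hC : C.card ≤ 1 := by
    rw [Finset.card_le_one]
    intro i hi j hj
    by_contra hne
    obtain ⟨-, i1, i2⟩ := Finset.mem_filter.1 hi
    obtain ⟨-, j1, j2⟩ := Finset.mem_filter.1 hj
    have h1 : w.len ≤ |s i - s j| := a3 hne
    have h2 : |s i - s j| < w.len := by rw [abs_lt]; constructor <;> linarith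
    linarith
  have hcov : (Finset.univ : Finset (Fin n)) ⊆ A ∪ B ∪ C := by
    intro i _
    simp only [A, B, C, Finset.mem_union, Finset.mem_filter, Finset.mem_univ, true_and]
    by_cases h1 : s i + w.len ≤ t
    · exact Or.inl (Or.inl h1)
    · by_cases h2 : t ≤ s i
      · exact Or.inl (Or.inr h2)
      · exact Or.inr ⟨not_le.1 h2, not_le.1 h1⟩
  have h1 := Finset.card_le_card hcov
  rw [Finset.card_univ, Fintype.card_fin] at h1
  have h2 := Finset.card_union_le (A ∪ B) C
  have h3 := Finset.card_union_le A B
  omega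

theorem HasCopies.reverse {w α : ArcPath S} {n : ℕ} (h : HasCopies Γ w α n) :
    HasCopies Γ w.reverse α.reverse n := by
  obtain ⟨s, g, a1, a2, a3⟩ := h
  refine ⟨fun i => α.len - s i - w.len, g, fun i => ?_, fun i t ht => ?_, fun i j hij => ?_⟩
  · have := a1 i
    simp only [ArcPath.reverse]
    constructor <;> linarith
  · have ht' : t ∈ Icc 0 w.len := ht
    have := a2 i (w.len - t) ⟨by linarith [ht'.2], by linarith [ht'.1]⟩
    simp only [ArcPath.reverse]
    rw [← this]
    congr 1; ring
  · have : w.len ≤ |s i - s j| := a3 hij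
    simp only [ArcPath.reverse]
    rw [abs_sub_comm] at this
    convert this using 2
    ring

theorem copyCount_reverse (w α : ArcPath S) :
    copyCount Γ w.reverse α.reverse = copyCount Γ w α := by
  unfold copyCount
  congr 1
  ext n
  refine ⟨fun h => ?_, HasCopies.reverse⟩
  have := HasCopies.reverse h
  rwa [ArcPath.reverse_reverse, ArcPath.reverse_reverse] at this

theorem HasCopies.smul [IsIsometricSMul Γ S] {w α : ArcPath S} {n : ℕ} (h : HasCopies Γ w α n)
    (γ : Γ) : HasCopies Γ w (α.smul γ) n := by
  obtain ⟨s, g, a1, a2, a3⟩ := h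
  refine ⟨s, fun i => γ * g i, a1, fun i t ht => ?_, a3⟩
  simp only [ArcPath.smul]
  rw [a2 i t ht, mul_smul]

theorem copyCount_le_smul [IsIsometricSMul Γ S] {w : ArcPath S} (hw : 0 < w.len) (α : ArcPath S)
    (γ : Γ) : copyCount Γ w α ≤ copyCount Γ w (α.smul γ) :=
  ((hasCopies_copyCount hw α).smul γ).le_copyCount hw

end CopyCount

/-! ### The cost function as an invariant asymmetric pseudo-distance. -/

section PathCost

variable {Γ : Type*} [Group Γ] {S : Type*} [MetricSpace S] [MulAction Γ S]

variable (Γ) in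
/-- `inf_α (|α| - W |α|_w)` over the paths `α` from `x` to `y`. -/
def pathCost (w : ArcPath S) (W : ℝ) (x y : S) : ℝ :=
  sInf {b : ℝ | ∃ α : ArcPath S, α.Joins x y ∧ b = α.len - W * copyCount Γ w α}

theorem countingFunction_eq (w : ArcPath S) (W : ℝ) (x y : S) :
    countingFunction Γ w W x y = dist x y - pathCost Γ w W x y := rfl

variable {w : ArcPath S} {W : ℝ}

/-- Every path costs at least half its length. This bounds the infimum in `pathCost` from below and
later makes almost minimizing paths quasi-geodesic. -/
theorem mul_copyCount_le (hW : 0 < W) (hw : 2 * W ≤ w.len) (α : ArcPath S) :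
    W * copyCount Γ w α ≤ α.len / 2 := by
  have h := copyCount_mul_len_le (Γ := Γ) (show 0 < w.len by linarith) α
  have : (0 : ℝ) ≤ copyCount Γ w α := Nat.cast_nonneg _
  nlinarith

theorem pathCost_le (hW : 0 < W) (hw : 2 * W ≤ w.len) {x y : S} {α : ArcPath S}
    (h : α.Joins x y) : pathCost Γ w W x y ≤ α.len - W * copyCount Γ w α := by
  refine csInf_le ⟨0, ?_⟩ ⟨α, h, rfl⟩
  rintro _ ⟨β, -, rfl⟩
  have := mul_copyCount_le (Γ := Γ) hW hw β
  have := β.len_nonneg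
  linarith

theorem exists_joins_lt {δ : ℝ} (hS : IsHyperbolic δ S) {x y : S} {c : ℝ}
    (h : pathCost Γ w W x y < c) :
    ∃ α : ArcPath S, α.Joins x y ∧ α.len - W * copyCount Γ w α < c := by
  obtain ⟨p, -, hp⟩ := hS.geodesic x y
  obtain ⟨_, ⟨α, h1, rfl⟩, h2⟩ := exists_lt_of_csInf_lt (s := {b : ℝ | ∃ α : ArcPath S,
    α.Joins x y ∧ b = α.len - W * copyCount Γ w α}) ⟨_, p, hp, rfl⟩ h
  exact ⟨α, h1, h2⟩

theorem pathCost_le_dist {δ : ℝ} (hS : IsHyperbolic δ S) (hW : 0 < W) (hw : 2 * W ≤ w.len)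
    (x y : S) : pathCost Γ w W x y ≤ dist x y := by
  obtain ⟨p, hg, hp⟩ := hS.geodesic x y
  have h1 := pathCost_le (Γ := Γ) hW hw hp
  have h2 := hg.len_eq hp
  have : 0 ≤ W * copyCount Γ w p := by positivity
  linarith

theorem pathCost_triangle {δ : ℝ} (hS : IsHyperbolic δ S) (hW : 0 < W) (hw : 2 * W ≤ w.len)
    (x y z : S) : pathCost Γ w W x z ≤ pathCost Γ w W x y + pathCost Γ w W y z := by
  refine le_of_forall_pos_le_add fun ε hε => ?_
  obtain ⟨α, h1, h2⟩ := exists_joins_lt (Γ := Γ) (w := w) (W := W) hS (x := x) (y := y)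
    (lt_add_of_pos_right _ (half_pos hε))
  obtain ⟨β, h3, h4⟩ := exists_joins_lt (Γ := Γ) (w := w) (W := W) hS (x := y) (y := z)
    (lt_add_of_pos_right _ (half_pos hε))
  have h5 := pathCost_le (Γ := Γ) hW hw (h1.trans h3)
  have h6 := copyCount_add_le_trans (Γ := Γ) (show 0 < w.len by linarith)
    (h1.2.trans h3.1.symm)
  have h7 : (copyCount Γ w α : ℝ) + copyCount Γ w β ≤
    copyCount Γ w (α.trans β (h1.2.trans h3.1.symm)) := by exact_mod_cast h6
  have h8 : (α.trans β (h1.2.trans h3.1.symm)).len = α.len + β.len := rfl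
  have h9 := mul_le_mul_of_nonneg_left h7 hW.le
  linarith

theorem pathCost_reverse (x y : S) :
    pathCost Γ w.reverse W x y = pathCost Γ w W y x := by
  unfold pathCost
  congr 1
  ext b
  constructor
  · rintro ⟨α, h, rfl⟩
    refine ⟨α.reverse, h.reverse, ?_⟩
    conv_rhs => rw [← copyCount_reverse, ArcPath.reverse_reverse]
    rfl
  · rintro ⟨α, h, rfl⟩
    refine ⟨α.reverse, h.reverse, ?_⟩
    rw [copyCount_reverse]
    rfl

/-- Reversing paths exchanges w with w⁻¹ and the endpoints, so h is the antisymmetrization of a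
single cost function. -/
theorem epsteinFujiwara_eq (x₀ : S) (a : Γ) :
    epsteinFujiwara w W x₀ a = pathCost Γ w W (a • x₀) x₀ - pathCost Γ w W x₀ (a • x₀) := by
  rw [epsteinFujiwara, countingFunction_eq, countingFunction_eq, pathCost_reverse]
  ring

variable [IsIsometricSMul Γ S]

theorem pathCost_smul {δ : ℝ} (hS : IsHyperbolic δ S) (hW : 0 < W) (hw : 2 * W ≤ w.len) (γ : Γ)
    (x y : S) : pathCost Γ w W (γ • x) (γ • y) = pathCost Γ w W x y := by
  have key : ∀ (γ : Γ) (x y : S), pathCost Γ w W (γ • x) (γ • y) ≤ pathCost Γ w W x y := by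
    intro γ x y
    refine le_of_forall_pos_le_add fun ε hε => ?_
    obtain ⟨α, h1, h2⟩ := exists_joins_lt (Γ := Γ) (w := w) (W := W) hS (x := x) (y := y)
      (lt_add_of_pos_right _ hε)
    have h3 := pathCost_le (Γ := Γ) hW hw (h1.smul γ)
    have h4 : (copyCount Γ w α : ℝ) ≤ copyCount Γ w (α.smul γ) := by
      exact_mod_cast copyCount_le_smul (show 0 < w.len by linarith) α γ
    have h5 : (α.smul γ).len = α.len := rfl
    have h6 := mul_le_mul_of_nonneg_left h4 hW.le
    linarith
  refine le_antisymm (key γ x y) ?_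
  have := key γ⁻¹ (γ • x) (γ • y)
  rwa [inv_smul_smul, inv_smul_smul] at this

end PathCost

/-! ### Almost minimizing paths. -/

section NearMinimizers

variable {Γ : Type*} [Group Γ] {S : Type*} [MetricSpace S] [MulAction Γ S]
  {w : ArcPath S} {W δ : ℝ}

/-- Cutting a path at time `t` loses at most one copy of `w`. -/
theorem pathCost_add_pathCost_le (hW : 0 < W) (hw : 2 * W ≤ w.len) {x y : S} {α : ArcPath S}
    (h : α.Joins x y) {t : ℝ} (ht : t ∈ Icc 0 α.len) :
    pathCost Γ w W x (α.toFun t) + pathCost Γ w W (α.toFun t) y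
      ≤ α.len - W * copyCount Γ w α + W := by
  have h1 := pathCost_le (Γ := Γ) hW hw (α.sub_joins le_rfl ht.1 ht.2)
  have h2 := pathCost_le (Γ := Γ) hW hw (α.sub_joins ht.1 ht.2 le_rfl)
  rw [h.1] at h1
  rw [h.2] at h2
  have h3 : (copyCount Γ w α : ℝ) ≤ copyCount Γ w (α.sub 0 t le_rfl ht.1 ht.2)
      + copyCount Γ w (α.sub t α.len ht.1 ht.2 le_rfl) + 1 := by
    exact_mod_cast copyCount_le_sub_add_sub (show 0 < w.len by linarith) α ht.1 ht.2
  have h4 := mul_le_mul_of_nonneg_left h3 hW.le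
  simp only [ArcPath.sub] at h1 h2 h4 ⊢
  linarith

/-- Almost minimizing paths are quasi-geodesics. -/
theorem sub_le_of_almost_minimizing (hS : IsHyperbolic δ S) (hW : 0 < W) (hw : 2 * W ≤ w.len)
    {x y : S} {α : ArcPath S} (h : α.Joins x y)
    (hα : α.len - W * copyCount Γ w α ≤ pathCost Γ w W x y + 1) {s t : ℝ}
    (hs : s ∈ Icc 0 α.len) (ht : t ∈ Icc 0 α.len) :
    |s - t| ≤ 2 * dist (α.toFun s) (α.toFun t) + (4 * W + 2) := by
  wlog hst : s ≤ t generalizing s t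
  · rw [abs_sub_comm, dist_comm]
    exact this ht hs (le_of_not_ge hst)
  rw [abs_sub_comm, abs_of_nonneg (by linarith)]
  have hw0 : 0 < w.len := by linarith
  -- Cutting at s and then at t loses at most 2W and almost minimality at most 1, while the middle
  -- piece costs at least (t − s)/2 and cannot be much dearer than a geodesic. Doubling gives 4W +
  -- 2.
  let β := α.sub s α.len hs.1 hs.2 le_rfl
  have hβl : β.len = α.len - s := rfl
  have ht' : t - s ∈ Icc 0 β.len := ⟨by linarith, by rw [hβl]; linarith [ht.2]⟩
  have hβt : β.toFun (t - s) = α.toFun t := by simp [β, ArcPath.sub]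
  have a1 := pathCost_le (Γ := Γ) hW hw (α.sub_joins le_rfl hs.1 hs.2)
  have a2 := pathCost_le (Γ := Γ) hW hw (β.sub_joins ht'.1 ht'.2 le_rfl)
  have a3 := pathCost_le_dist (Γ := Γ) hS hW hw (α.toFun s) (α.toFun t)
  have b1 : (copyCount Γ w α : ℝ) ≤ copyCount Γ w (α.sub 0 s le_rfl hs.1 hs.2)
      + copyCount Γ w β + 1 := by
    exact_mod_cast copyCount_le_sub_add_sub hw0 α hs.1 hs.2
  have b2 : (copyCount Γ w β : ℝ) ≤ copyCount Γ w (β.sub 0 (t - s) le_rfl ht'.1 ht'.2)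
      + copyCount Γ w (β.sub (t - s) β.len ht'.1 ht'.2 le_rfl) + 1 := by
    exact_mod_cast copyCount_le_sub_add_sub hw0 β ht'.1 ht'.2
  have b3 := mul_copyCount_le (Γ := Γ) hW hw (β.sub 0 (t - s) le_rfl ht'.1 ht'.2)
  have c1 := mul_le_mul_of_nonneg_left b1 hW.le
  have c2 := mul_le_mul_of_nonneg_left b2 hW.le
  have e1 : β.toFun β.len = y := by rw [← h.2]; simp [β, ArcPath.sub]
  rw [h.1] at a1
  rw [e1, hβt] at a2
  have d1 := pathCost_triangle (Γ := Γ) hS hW hw x (α.toFun s) y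
  have d2 := pathCost_triangle (Γ := Γ) hS hW hw (α.toFun s) (α.toFun t) y
  have l1 : (α.sub 0 s le_rfl hs.1 hs.2).len = s - 0 := rfl
  have l2 : (β.sub 0 (t - s) le_rfl ht'.1 ht'.2).len = t - s - 0 := rfl
  have l3 : (β.sub (t - s) β.len ht'.1 ht'.2 le_rfl).len = β.len - (t - s) := rfl
  linarith

end NearMinimizers

/-! ### Uniform bound on the defect. -/

section Defect

/-- An almost minimizing path passes within D of p. The error collects 1 for almost minimality, W
for the copy cut there, and 2D for the detour to p and back. -/
theorem exists_pathCost_split.{u₁, v₁} {δ W : ℝ} (hδ : 0 < δ) (hW : 0 < W) : ∃ e : ℝ, 0 ≤ e ∧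
    ∀ (Γ : Type u₁) [Group Γ] (S : Type v₁) [MetricSpace S] [MulAction Γ S],
      IsHyperbolic δ S → ∀ w : ArcPath S, 2 * W ≤ w.len → ∀ x p z : S,
      dist x p + dist p z ≤ dist x z + 4 * δ →
      pathCost Γ w W x p + pathCost Γ w W p z ≤ pathCost Γ w W x z + e := by
  obtain ⟨D, hD, hM⟩ := exists_quasigeodesic_stability.{v₁} δ (4 * δ) (4 * W + 2) hδ
    (by positivity)
  refine ⟨1 + W + 2 * D, by positivity, ?_⟩
  intro Γ _ S _ _ hS w hw x p z hp
  obtain ⟨α, hα, hlt⟩ := exists_joins_lt (Γ := Γ) (w := w) (W := W) hS (x := x) (y := z)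
    (lt_add_of_pos_right _ one_pos)
  obtain ⟨s, hs, h1⟩ := (hM S hS α.toFun 0 α.len α.len_nonneg
    (fun s hs t ht => α.dist_le hs ht)
    (fun s hs t ht => sub_le_of_almost_minimizing (Γ := Γ) hS hW hw hα hlt.le hs ht)).1 p
    (by rw [hα.1, hα.2]; exact hp)
  have h2 := pathCost_add_pathCost_le (Γ := Γ) hW hw hα hs
  have h3 := pathCost_triangle (Γ := Γ) hS hW hw x (α.toFun s) p
  have h4 := pathCost_triangle (Γ := Γ) hS hW hw p (α.toFun s) z
  have h5 := pathCost_le_dist (Γ := Γ) hS hW hw (α.toFun s) p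
  have h6 := pathCost_le_dist (Γ := Γ) hS hW hw p (α.toFun s)
  rw [dist_comm] at h5
  linarith

/-- The Epstein-Fujiwara functions are quasimorphisms with a uniform bound on the defect. -/
theorem exists_defect_bound.{u₁, v₁} {δ W : ℝ} (hδ : 0 < δ) (hW : 0 < W) : ∃ E : ℝ, 0 ≤ E ∧
    ∀ (Γ : Type u₁) [Group Γ] (S : Type v₁) [MetricSpace S] [MulAction Γ S] [IsIsometricSMul Γ S],
      IsHyperbolic δ S → ∀ w : ArcPath S, 2 * W ≤ w.len → ∀ (x₀ : S) (a b : Γ),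
      |epsteinFujiwara w W x₀ (a * b) - epsteinFujiwara w W x₀ a
        - epsteinFujiwara w W x₀ b| ≤ E := by
  obtain ⟨e, he, hsplit⟩ := exists_pathCost_split.{u₁, v₁} hδ hW
  refine ⟨3 * e, by positivity, ?_⟩
  intro Γ _ S _ _ _ hS w hw x₀ a b
  simp only [epsteinFujiwara_eq]
  set x := x₀
  set y := a • x₀
  set z := (a * b) • x₀ with hz
  have e1 : pathCost Γ w W (b • x₀) x₀ = pathCost Γ w W z y := by
    rw [hz, mul_smul, pathCost_smul hS hW hw]
  have e2 : pathCost Γ w W x₀ (b • x₀) = pathCost Γ w W y z := by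
    rw [hz, mul_smul, pathCost_smul hS hW hw]
  rw [e1, e2]
  obtain ⟨γ, hγ, hj⟩ := hS.geodesic x y
  obtain ⟨t, ht, c1, c2⟩ := hS.exists_center hδ hγ hj z
  have d1 := hγ.dist_left hj ht
  have d2 := hγ.dist_right hj ht
  have d3 := hγ.len_eq hj
  set p := γ.toFun t
  have c3 : dist x p + dist p y ≤ dist x y + 4 * δ := by linarith
  have sw : ∀ u v : S, dist u p + dist p v ≤ dist u v + 4 * δ →
      dist v p + dist p u ≤ dist v u + 4 * δ := by
    intro u v h
    rw [dist_comm v p, dist_comm p u, dist_comm v u]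
    linarith
  -- All six directed side costs split at the centre p. The antisymmetrized costs between p and the
  -- vertices cancel around the triangle, leaving an error e per side.
  have s := hsplit Γ S hS w hw
  have t := pathCost_triangle (Γ := Γ) hS hW hw
  have s1 := s x p y c3
  have s2 := s y p x (sw _ _ c3)
  have s3 := s x p z c1
  have s4 := s z p x (sw _ _ c1)
  have s5 := s y p z c2
  have s6 := s z p y (sw _ _ c2)
  have t1 := t x p y
  have t2 := t y p x
  have t3 := t x p z
  have t4 := t z p x
  have t5 := t y p z
  have t6 := t z p y
  rw [abs_le]
  constructor <;> linarith

end Defect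

/-! ### Chirality excludes reversed copies. -/

section ReversedCopies

variable {Γ : Type*} [Group Γ] {S : Type*} [MetricSpace S] [MulAction Γ S] [IsIsometricSMul Γ S]
  [Nonempty S]

/-- With m = j − i the equation cancels to γ = g⁻ᵐγg⁻ᵐ, that is γ⁻¹gᵐγ = g⁻ᵐ. -/
theorem isAchiral_of_twisted_eq {g γ : Γ} {i j : ℕ} (hij : i < j)
    (h : (g ^ i)⁻¹ * γ * (g ^ i)⁻¹ * γ⁻¹ = (g ^ j)⁻¹ * γ * (g ^ j)⁻¹ * γ⁻¹) : IsAchiral g := by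
  obtain ⟨m, rfl⟩ := Nat.exists_eq_add_of_lt hij
  refine ⟨m + 1, by omega, isConj_iff.2 ⟨γ⁻¹, ?_⟩⟩
  have h1 : (g ^ i)⁻¹ * γ * (g ^ i)⁻¹ =
      (g ^ i)⁻¹ * ((g ^ (m + 1))⁻¹ * γ * (g ^ (m + 1))⁻¹) * (g ^ i)⁻¹ := by
    have h2 := mul_right_cancel h
    have e1 : (g ^ (i + m + 1))⁻¹ = (g ^ i)⁻¹ * (g ^ (m + 1))⁻¹ := by
      rw [← mul_inv_rev, ← pow_add]; congr 2; ring
    have e2 : (g ^ (i + m + 1))⁻¹ = (g ^ (m + 1))⁻¹ * (g ^ i)⁻¹ := by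
      rw [← mul_inv_rev, ← pow_add]; rfl
    rw [h2]
    nth_rewrite 1 [e1]
    rw [e2]
    group
  have h3 := mul_left_cancel (mul_right_cancel h1)
  rw [inv_inv, mul_assoc, inv_mul_eq_iff_eq_mul]
  nth_rewrite 1 [h3]
  group

/-- If a long segment of the axis of `g` is mapped by some `γ` close to the axis of `g`, but in
the opposite direction, then `g` is achiral. -/
theorem AcylindricalWith.isAchiral_of_reversed_segment {R : ℝ → ℝ} {N : ℝ → ℕ}
    (hac : AcylindricalWith Γ S R N) {Δ : ℝ} (hΔ : FourPoint Δ S) {B A r : ℝ} {g γ : Γ} {x : S}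
    (hx : IsAxisPoint B g x) {n M : ℕ} (hr : 0 < r) (hr' : 5 * B + A + Δ ≤ r) (hM : N r ≤ M)
    (hR : R r ≤ (M - N r) * translationLength S g)
    (hal : dist x (γ • g ^ M • x) + dist (γ • g ^ M • x) (γ • x) + dist (γ • x) (g ^ n • x)
      ≤ dist x (g ^ n • x) + A) : IsAchiral g := by
  have hB := hx.nonneg
  set τ := translationLength S g
  let u : ℕ → S := fun j => γ • g ^ j • x
  have hu : ∀ j i, dist (u j) (u (j + i)) = dist x (g ^ i • x) := by
    intro j i
    simp only [u]
    rw [dist_smul, dist_pow_smul_pow_smul]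
  have hle : ∀ j i, dist (u j) (u (j + i)) ≤ i * τ + B := fun j i => (hu j i).trans_le (hx.2 i)
  have hge : ∀ j i, i * τ ≤ dist (u j) (u (j + i)) := fun j i =>
    (mul_translationLength_le g x i).trans_eq (hu j i).symm
  have hu0 : u 0 = γ • x := by simp [u]
  have hMτ : M * τ ≤ dist (u M) (u 0) := by
    have := hge 0 M
    rwa [zero_add, dist_comm] at this
  change dist x (u M) + dist (u M) _ + _ ≤ _ at hal
  rw [← hu0] at hal
  set y := g ^ n • x with hy
  -- γg⁻ⁱγ⁻¹ takes u j to u (j − i), about iτ further towards y because u runs backwards; g⁻ⁱ then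
  -- brings it back near u j.
  let φ : ℕ → Γ := fun i => (g ^ i)⁻¹ * γ * (g ^ i)⁻¹ * γ⁻¹
  have key : ∀ i j, i ≤ j → j ≤ M → dist (u j) (φ i • u j) ≤ r := by
    intro i j hij hjM
    obtain ⟨l, rfl⟩ := Nat.exists_eq_add_of_le' hij
    obtain ⟨k, rfl⟩ := Nat.exists_eq_add_of_le hjM
    have e0 : dist (u (l + i)) (φ i • u (l + i)) = dist (u l) (g ^ i • u (l + i)) := by
      rw [← dist_smul (g ^ i), dist_comm]
      congr 1
      simp only [φ, u, smul_smul]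
      congr 1
      rw [add_comm l i, pow_add]
      group
    rw [e0]
    have a1 : dist (u (l + i)) (u (l + i + k)) ≤ k * τ + B := hle _ _
    have a2 : dist (u l) (u (l + i + k)) ≤ (i + k) * τ + B := by
      have := hle l (i + k)
      rw [← add_assoc] at this
      exact_mod_cast this
    have a3 : dist (u 0) (u l) ≤ l * τ + B := by simpa using hle 0 l
    have a4 : dist (u 0) (u (l + i)) ≤ (l + i) * τ + B := by
      simpa using hle 0 (l + i)
    have b1 : dist (g ^ i • y) (g ^ i • u (l + i)) = dist y (u (l + i)) := dist_smul _ _ _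
    have b2 : dist x (g ^ i • u (l + i)) ≤ i * τ + B + dist x (u (l + i)) := by
      have h1 := dist_triangle x (g ^ i • x) (g ^ i • u (l + i))
      rw [dist_smul] at h1
      linarith [hx.2 i]
    have b3 : dist y (g ^ i • y) ≤ i * τ + B := by
      rw [hy, dist_smul_comm_smul ((Commute.refl g).pow_pow i n)]
      exact hx.2 i
    have b4 : (n + i) * τ ≤ dist x (g ^ i • y) := by
      have := mul_translationLength_le g x (i + n)
      rw [pow_add, mul_smul] at this
      push_cast at this
      linarith
    have b5 : dist x y ≤ n * τ + B := hx.2 n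
    have t1 := dist_triangle x (u (l + i + k)) (u l)
    have t2 := dist_triangle y (u 0) (u (l + i))
    have t3 := dist_triangle x (u (l + i + k)) (u (l + i))
    have t4 := dist_triangle4 (g ^ i • y) y (u 0) (u l)
    have c1 := dist_comm (u (l + i + k)) (u l)
    have c2 := dist_comm (u (l + i + k)) (u (l + i))
    have c3 := dist_comm y (u 0)
    have c4 := dist_comm (g ^ i • y) y
    push_cast at hMτ
    rcases hΔ.or x (g ^ i • y) (u l) (g ^ i • u (l + i)) with h | h <;> linarith
  have hdist : R r ≤ dist (u M) (u (N r)) := by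
    have := hge (N r) (M - N r)
    rw [Nat.add_sub_cancel' hM, Nat.cast_sub hM, dist_comm] at this
    exact hR.trans this
  obtain ⟨i, j, hij, -, h⟩ := hac.exists_eq_of_dist_le hr hdist φ
    (fun i hi => key i M (hi.trans hM) le_rfl) (fun i hi => key i (N r) hi hM)
  exact isAchiral_of_twisted_eq hij h

/-- For chiral `g`, almost minimizing paths along the axis of `g` contain no reversed copies. -/
theorem exists_dist_le_pathCost_reverse.{u₁, v₁} {δ W B : ℝ} (hδ : 0 < δ) (hW : 0 < W)
    (hB : 0 ≤ B) : ∃ r : ℝ, 0 < r ∧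
    ∀ (Γ : Type u₁) [Group Γ] (S : Type v₁) [MetricSpace S] [Nonempty S] [MulAction Γ S]
      [IsIsometricSMul Γ S] (R : ℝ → ℝ) (N : ℝ → ℕ),
      IsHyperbolic δ S → AcylindricalWith Γ S R N → ∀ (g : Γ) (x : S), IsAxisPoint B g x →
      ¬ IsAchiral g → ∀ M : ℕ, N r ≤ M → R r ≤ (M - N r) * translationLength S g →
      ∀ w : ArcPath S, w.Joins x (g ^ M • x) → 2 * W ≤ w.len → ∀ n : ℕ,
      dist x (g ^ n • x) ≤ pathCost Γ w.reverse W x (g ^ n • x) := by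
  obtain ⟨D, hD, hMorse⟩ := exists_quasigeodesic_stability.{v₁} δ (4 * δ) (4 * W + 2) hδ
    (by positivity)
  refine ⟨5 * B + 2 * D + 8 * δ, by positivity, ?_⟩
  intro Γ _ S _ _ _ _ R N hS hac g x hx hch M hNM hR w hw hwW n
  by_contra! hlt
  refine hch ?_
  set y := g ^ n • x with hy
  have hwW' : 2 * W ≤ w.reverse.len := hwW
  have hw0 : 0 < w.reverse.len := by linarith
  -- One path does both jobs: costing less than the distance, it must contain a copy of w⁻¹; being
  -- almost minimizing, it is a quasi-geodesic.
  obtain ⟨α, hα, h1⟩ := exists_joins_lt (Γ := Γ) (w := w.reverse) (W := W) hS (x := x) (y := y)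
    (lt_min hlt (lt_add_of_pos_right _ one_pos))
  have h2 := h1.trans_le (min_le_left _ _)
  have h3 := h1.trans_le (min_le_right _ _)
  have hpos : 0 < copyCount Γ w.reverse α := by
    by_contra h
    have h0 : copyCount Γ w.reverse α = 0 := by omega
    rw [h0, Nat.cast_zero, mul_zero, sub_zero] at h2
    linarith [hα.dist_le]
  obtain ⟨s, γ, a1, a2, -⟩ := hasCopies_copyCount (Γ := Γ) hw0 α
  let i : Fin (copyCount Γ w.reverse α) := ⟨0, hpos⟩
  have hs : s i ∈ Icc 0 α.len := ⟨(a1 i).1, by linarith [(a1 i).2]⟩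
  have hs' : s i + w.reverse.len ∈ Icc (s i) α.len := ⟨by linarith, (a1 i).2⟩
  have e1 : α.toFun (s i) = γ i • g ^ M • x := by
    have := a2 i 0 ⟨le_rfl, hw0.le⟩
    rwa [add_zero, hw.reverse.1] at this
  have e2 : α.toFun (s i + w.reverse.len) = γ i • x := by
    rw [a2 i _ ⟨hw0.le, le_rfl⟩, hw.reverse.2]
  have hq : ∀ a ∈ Icc 0 α.len, ∀ b ∈ Icc 0 α.len,
      |a - b| ≤ 2 * dist (α.toFun a) (α.toFun b) + (4 * W + 2) := fun a ha b hb =>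
    sub_le_of_almost_minimizing (Γ := Γ) hS hW hwW' hα h3.le ha hb
  -- Stability is used on all of α for the start of the copy, and on the tail of α for its end; the
  -- two errors D give A = 2D.
  have m1 := (hMorse S hS α.toFun 0 α.len α.len_nonneg (fun s hs t ht => α.dist_le hs ht)
    hq).2 _ hs
  have m2 := (hMorse S hS α.toFun (s i) α.len hs.2
    (fun a ha b hb => α.dist_le ⟨hs.1.trans ha.1, ha.2⟩ ⟨hs.1.trans hb.1, hb.2⟩)
    (fun a ha b hb => hq a ⟨hs.1.trans ha.1, ha.2⟩ b ⟨hs.1.trans hb.1, hb.2⟩)).2 _ hs'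
  rw [hα.1, hα.2, e1] at m1
  rw [hα.2, e1, e2] at m2
  exact hac.isAchiral_of_reversed_segment (hS.fourPoint hδ) hx (A := 2 * D) (n := n) (γ := γ i)
    (by positivity) le_rfl hNM hR (by linarith)

end ReversedCopies

/-! ### Homogenization of quasimorphisms. -/

section Quasimorphism

variable {Γ : Type*} [Group Γ] {ψ : Γ → ℝ} {E : ℝ}

theorem abs_pow_sub_le (hψ : ∀ a b, |ψ (a * b) - ψ a - ψ b| ≤ E) (g : Γ) (n : ℕ) :
    |ψ (g ^ n) - n * ψ g| ≤ (n + 1) * E := by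
  induction n with
  | zero =>
    have := hψ 1 1
    rw [mul_one, sub_self, zero_sub, abs_neg] at this
    simpa using this
  | succ n ih =>
    have := hψ (g ^ n) g
    rw [← pow_succ] at this
    rw [abs_le] at this ih ⊢
    push_cast
    constructor <;> linarith

/-- ψ(gⁿ) + E is subadditive in n, so Fekete's lemma applies, and the added E/n vanishes in the
limit. -/
theorem tendsto_homogenization (hψ : ∀ a b, |ψ (a * b) - ψ a - ψ b| ≤ E) (g : Γ) :
    Tendsto (fun n : ℕ => ψ (g ^ n) / n) atTop (𝓝 (homogenization ψ g)) := by
  have hsub : Subadditive fun n : ℕ => ψ (g ^ n) + E := by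
    intro m n
    have := (abs_le.1 (hψ (g ^ m) (g ^ n))).2
    rw [← pow_add] at this
    linarith
  have hbdd : BddBelow (range fun n : ℕ => (ψ (g ^ n) + E) / n) := by
    refine ⟨-(|ψ g| + E), ?_⟩
    rintro _ ⟨n, rfl⟩
    have hE : 0 ≤ E := (abs_nonneg _).trans (hψ 1 1)
    rcases Nat.eq_zero_or_pos n with rfl | hn
    · simp only [Nat.cast_zero, div_zero]
      linarith [abs_nonneg (ψ g)]
    · have h1 := (abs_le.1 (abs_pow_sub_le hψ g n)).1
      have h2 := mul_le_mul_of_nonneg_left (neg_abs_le (ψ g)) (Nat.cast_nonneg (α := ℝ) n)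
      simp only
      rw [le_div_iff₀ (by positivity)]
      linarith
  have h1 := (hsub.tendsto_lim hbdd).sub (tendsto_const_div_atTop_nhds_zero_nat E)
  refine tendsto_nhds_limUnder ⟨_, h1.congr fun n => ?_⟩
  rw [← sub_div, add_sub_cancel_right]

theorem abs_le_abs_homogenization_add (hψ : ∀ a b, |ψ (a * b) - ψ a - ψ b| ≤ E) (g : Γ) :
    |ψ g| ≤ |homogenization ψ g| + 2 * E := by
  have hE : 0 ≤ E := (abs_nonneg _).trans (hψ 1 1)
  have h1 := ((tendsto_homogenization hψ g).sub_const (ψ g)).abs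
  have h2 : |homogenization ψ g - ψ g| ≤ 2 * E := by
    refine le_of_tendsto h1 ?_
    filter_upwards [eventually_gt_atTop 0] with n hn
    have hn' : (1 : ℝ) ≤ n := by exact_mod_cast hn
    have h3 := abs_pow_sub_le hψ g n
    have h4 : ψ (g ^ n) / n - ψ g = (ψ (g ^ n) - n * ψ g) / n := by
      field_simp
    rw [h4, abs_div, Nat.abs_cast, div_le_iff₀ (by linarith)]
    nlinarith
  have h3 := abs_sub_abs_le_abs_sub (ψ g) (homogenization ψ g)
  rw [abs_sub_comm] at h3
  linarith

theorem homogenization_pow (hψ : ∀ a b, |ψ (a * b) - ψ a - ψ b| ≤ E) (g : Γ) {m : ℕ}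
    (hm : 0 < m) : homogenization ψ (g ^ m) = m * homogenization ψ g := by
  refine tendsto_nhds_unique (tendsto_homogenization hψ (g ^ m)) ?_
  have h := ((tendsto_homogenization hψ g).comp
    (tendsto_id.const_mul_atTop' hm)).const_mul (m : ℝ)
  refine h.congr fun n => ?_
  rcases Nat.eq_zero_or_pos n with rfl | hn
  · simp
  simp only [Function.comp, id, pow_mul, Nat.cast_mul]
  field_simp

theorem abs_list_prod_le (hψ : ∀ a b, |ψ (a * b) - ψ a - ψ b| ≤ E) {c : ℝ} {l : List Γ}
    (hl : ∀ a ∈ l, |ψ a| ≤ c) : |ψ l.prod| ≤ l.length * (c + E) + E := by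
  induction l with
  | nil =>
    have := hψ 1 1
    rw [mul_one, sub_self, zero_sub, abs_neg] at this
    simpa using this
  | cons a l ih =>
    have h1 := ih fun b hb => hl b (List.mem_cons_of_mem _ hb)
    have h2 := hl a List.mem_cons_self
    have h3 := hψ a l.prod
    rw [List.prod_cons, List.length_cons]
    push_cast
    rw [abs_le] at h1 h2 h3 ⊢
    constructor <;> linarith

end Quasimorphism

/-! ### Stable word norm: lower bound from quasimorphisms, vanishing from torsion. -/

section WordNorm

variable {Γ : Type*} [Group Γ] {A : Set Γ}

theorem wordNorm_le {g : Γ} {l : List Γ} (hl : ∀ a ∈ l, a ∈ A) (h : l.prod = g) :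
    wordNorm A g ≤ l.length :=
  Nat.sInf_le ⟨l, rfl, hl, h⟩

theorem exists_list_length_eq_wordNorm (hA : ∀ a ∈ A, a⁻¹ ∈ A) {g : Γ}
    (hg : g ∈ Subgroup.closure A) :
    ∃ l : List Γ, l.length = wordNorm A g ∧ (∀ a ∈ l, a ∈ A) ∧ l.prod = g := by
  rw [← Subgroup.mem_toSubmonoid, Subgroup.closure_toSubmonoid] at hg
  obtain ⟨l, h1, h2⟩ := Submonoid.exists_list_of_mem_closure hg
  refine Nat.sInf_mem (s := {n | ∃ l : List Γ, l.length = n ∧ (∀ a ∈ l, a ∈ A) ∧ l.prod = g})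
    ⟨l.length, l, rfl, fun a ha => ?_, h2⟩
  rcases h1 a ha with h | h
  · exact h
  · simpa using hA _ (Set.mem_inv.1 h)

theorem tendsto_stableWordNormAux (hA : ∀ a ∈ A, a⁻¹ ∈ A) {g : Γ}
    (hg : g ∈ Subgroup.closure A) :
    Tendsto (fun n : ℕ => (wordNorm A (g ^ n) : ℝ) / n) atTop (𝓝 (stableWordNormAux A g)) := by
  have hsub : Subadditive fun n : ℕ => (wordNorm A (g ^ n) : ℝ) := by
    intro m n
    obtain ⟨l, h1, h2, h3⟩ := exists_list_length_eq_wordNorm hA (pow_mem hg m)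
    obtain ⟨l', h1', h2', h3'⟩ := exists_list_length_eq_wordNorm hA (pow_mem hg n)
    have := wordNorm_le (A := A) (g := g ^ (m + n)) (l := l ++ l')
      (fun a ha => (List.mem_append.1 ha).elim (h2 a) (h2' a))
      (by rw [List.prod_append, h3, h3', pow_add])
    rw [List.length_append, h1, h1'] at this
    beta_reduce
    exact_mod_cast this
  exact tendsto_nhds_limUnder ⟨_, hsub.tendsto_lim ⟨0, by rintro _ ⟨n, rfl⟩; positivity⟩⟩

theorem exists_stableWordNorm_eq {g : Γ}
    (h : ∃ m : ℕ, 0 < m ∧ g ^ m ∈ Subgroup.closure A) : ∃ m : ℕ, 0 < m ∧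
      g ^ m ∈ Subgroup.closure A ∧
      stableWordNorm A g = ENNReal.ofReal (stableWordNormAux A (g ^ m) / m) := by
  classical
  unfold stableWordNorm
  rw [dif_pos h]
  exact ⟨_, (Nat.find_spec h).1, (Nat.find_spec h).2, rfl⟩

/-- Bavard-type lower bound for the stable word norm. -/
theorem abs_homogenization_le_stableWordNormAux (hA : ∀ a ∈ A, a⁻¹ ∈ A) {ψ : Γ → ℝ} {E C : ℝ}
    (hψ : ∀ a b, |ψ (a * b) - ψ a - ψ b| ≤ E) (hC : ∀ a ∈ A, |homogenization ψ a| ≤ C) {g : Γ}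
    (hg : g ∈ Subgroup.closure A) :
    |homogenization ψ g| ≤ stableWordNormAux A g * (C + 3 * E) := by
  have h1 := (tendsto_homogenization hψ g).abs
  have h2 := ((tendsto_stableWordNormAux hA hg).mul_const (C + 3 * E)).add
    (tendsto_const_div_atTop_nhds_zero_nat E)
  rw [add_zero] at h2
  refine le_of_tendsto_of_tendsto h1 h2 ?_
  filter_upwards [eventually_gt_atTop 0] with n hn
  obtain ⟨l, l1, l2, l3⟩ := exists_list_length_eq_wordNorm hA (pow_mem hg n)
  -- On A only the homogenization is bounded by C; ψ itself is bounded there by C + 2E, and each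
  -- multiplication adds another E.
  have h3 := abs_list_prod_le hψ (c := C + 2 * E) (l := l) fun a ha =>
    (abs_le_abs_homogenization_add hψ a).trans (by linarith [hC a (l2 a ha)])
  rw [l1, l3] at h3
  rw [abs_div, Nat.abs_cast, div_mul_eq_mul_div, ← add_div]
  refine div_le_div_of_nonneg_right ?_ (Nat.cast_nonneg n)
  linarith

/-- If `t` inverts a power of `g` and `A` contains all torsion, the stable word norm vanishes. -/
theorem stableWordNorm_eq_zero_of_inverts (hA : ∀ a ∈ A, a⁻¹ ∈ A)
    (hfin : ∀ a : Γ, IsOfFinOrder a → a ∈ A) {g t : Γ} (ht : IsOfFinOrder t) {m : ℕ} (hm : 0 < m)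
    (h : t * g ^ m * t⁻¹ = (g ^ m)⁻¹) : stableWordNorm A g = 0 := by
  have hword : ∀ j : ℕ, ∃ l : List Γ, l.length = 2 ∧ (∀ a ∈ l, a ∈ A) ∧
      l.prod = g ^ (2 * m * j) := by
    intro j
    -- With k = mj, g²ᵏ = (gᵏtg⁻ᵏ)t⁻¹ because t inverts gᵏ; both factors are torsion, whatever j is.
    refine ⟨[g ^ (m * j) * t * (g ^ (m * j))⁻¹, t⁻¹], rfl, ?_, ?_⟩
    · intro a ha
      simp only [List.mem_cons, List.not_mem_nil, or_false] at ha
      rcases ha with rfl | rfl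
      · exact hfin _ ((MulAut.conj (g ^ (m * j))).toMonoidHom.isOfFinOrder ht)
      · exact hfin _ ht.inv
    · have h1 : t * (g ^ (m * j))⁻¹ * t⁻¹ = g ^ (m * j) := by
        have h2 : t * g ^ (m * j) * t⁻¹ = (g ^ (m * j))⁻¹ := by
          rw [pow_mul, ← conj_pow, h, inv_pow]
        simpa [mul_assoc] using congrArg (·⁻¹) h2
      simp only [List.prod_cons, List.prod_nil, mul_one]
      calc g ^ (m * j) * t * (g ^ (m * j))⁻¹ * t⁻¹
          = g ^ (m * j) * (t * (g ^ (m * j))⁻¹ * t⁻¹) := by group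
        _ = g ^ (2 * m * j) := by rw [h1, ← pow_add]; congr 1; ring
  have hmem : g ^ (2 * m) ∈ Subgroup.closure A := by
    obtain ⟨l, -, h2, h3⟩ := hword 1
    rw [mul_one] at h3
    rw [← h3]
    exact Subgroup.list_prod_mem _ fun a ha => Subgroup.subset_closure (h2 a ha)
  obtain ⟨f, hf, hfA, he⟩ := exists_stableWordNorm_eq ⟨2 * m, by omega, hmem⟩
  have hzero : stableWordNormAux A (g ^ f) = 0 := by
    -- The exponent f in the definition of the norm need not be 2m, so the limit is taken along
    -- multiples of 2m, where (gᶠ)^(2mn) has word norm at most 2.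
    have h1 := (tendsto_stableWordNormAux hA hfA).comp
      (tendsto_id.const_mul_atTop' (show 0 < 2 * m by omega))
    refine tendsto_nhds_unique h1 ?_
    have h2 : Tendsto (fun n : ℕ => (2 : ℝ) / ((2 * m * n : ℕ) : ℝ)) atTop (𝓝 0) :=
      (tendsto_const_div_atTop_nhds_zero_nat 2).comp
        (tendsto_id.const_mul_atTop' (show 0 < 2 * m by omega))
    refine squeeze_zero (fun n => div_nonneg (Nat.cast_nonneg _) (Nat.cast_nonneg _))
      (fun n => ?_) h2
    simp only [Function.comp, id]
    obtain ⟨l, l1, l2, l3⟩ := hword (f * n)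
    have h3 := wordNorm_le (g := (g ^ f) ^ (2 * m * n)) l2
      (by rw [l3, ← pow_mul]; congr 1; ring)
    rw [l1] at h3
    refine div_le_div_of_nonneg_right ?_ (Nat.cast_nonneg _)
    exact_mod_cast h3
  rw [he, hzero, zero_div, ENNReal.ofReal_zero]

end WordNorm

/-! ### Admissible choices and the value of the quasimorphism at g. -/

section Admissible

variable {Γ : Type*} [Group Γ] {S : Type*} [MetricSpace S] [Nonempty S] [MulAction Γ S]
  [IsIsometricSMul Γ S]

theorem DisplacementConstants.isAxisPoint.{u₁, v₁} {δ T K : ℝ}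
    (h : DisplacementConstants.{u₁, v₁} δ T K) {Γ : Type u₁} [Group Γ] {S : Type v₁} [MetricSpace S]
    [Nonempty S] [MulAction Γ S] [IsIsometricSMul Γ S] (hS : IsHyperbolic δ S) {g : Γ}
    (hg : T ≤ translationLength S g) {x : S} (hx : AlmostMinimal δ g x) : IsAxisPoint K g x :=
  ⟨h.1.trans_le hg, fun n => (h.2.2 Γ S hS g hg x hx n).2⟩

theorem DisplacementConstants.exists_isAxisPoint_pow.{u₁, v₁} {δ T K : ℝ} (hδ : 0 < δ)
    (h : DisplacementConstants.{u₁, v₁} δ T K) {Γ : Type u₁} [Group Γ] {S : Type v₁} [MetricSpace S]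
    [Nonempty S] [MulAction Γ S] [IsIsometricSMul Γ S] (hS : IsHyperbolic δ S) {g : Γ}
    (hg : IsLoxodromic S g) : ∃ (p : ℕ) (x : S), IsAxisPoint K (g ^ p) x := by
  obtain ⟨p, hp⟩ := exists_nat_ge (T / translationLength S g)
  rw [div_le_iff₀ hg, ← translationLength_pow] at hp
  obtain ⟨x, hx⟩ := exists_almostMinimal (S := S) hδ (g ^ p)
  exact ⟨p, x, h.isAxisPoint hS hp hx⟩

/-- The bound on |w| comes from the orbit of gᵐ, with error K, not from the weaker axis constant for
g: the refund K + 1 has to exceed this error. -/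
theorem Admissible.isAxisPoint_and_len.{u₁, v₁} {δ T K : ℝ} (hδ : 0 < δ)
    (h : DisplacementConstants.{u₁, v₁} δ T K) {Γ : Type u₁} [Group Γ] {S : Type v₁} [MetricSpace S]
    [Nonempty S] [MulAction Γ S] [IsIsometricSMul Γ S] (hS : IsHyperbolic δ S) {M : ℕ}
    (hM : 0 < M) {g : Γ} {x : S} {w : ArcPath S} (ha : Admissible δ T K M g x w) :
    IsAxisPoint (2 * K + 2 * (8 * δ)) g x ∧ 2 * (K + 1) ≤ w.len ∧
      w.len ≤ M * translationLength S g + K := by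
  obtain ⟨⟨m, ⟨k, rfl⟩, hm, hx⟩, hw, hj⟩ := ha
  have hax := h.isAxisPoint hS ((le_max_left _ _).trans hm) hx
  have hk : (1 : ℝ) ≤ k := by
    have : 0 < k := Nat.pos_of_mul_pos_left hM
    exact_mod_cast this
  have hm2 := (le_max_right _ _).trans hm
  have hlen := hw.len_eq hj
  rw [pow_mul] at hlen
  have h1 := hax.2 k
  have h2 := mul_translationLength_le (g ^ m) x k
  have h3 := le_mul_of_one_le_left hax.1.le hk
  refine ⟨hax.of_pow (hS.fourPoint hδ), by linarith, ?_⟩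
  rw [hlen]
  rw [translationLength_pow] at h1
  push_cast
  linarith

/-- An achiral loxodromic element of an acylindrical action has vanishing stable word norm. -/
theorem stableWordNorm_eq_zero_of_isAchiral.{u₁, v₁} {δ T K : ℝ} (hδ : 0 < δ)
    (h : DisplacementConstants.{u₁, v₁} δ T K) {Γ : Type u₁} [Group Γ] {S : Type v₁} [MetricSpace S]
    [Nonempty S] [MulAction Γ S] [IsIsometricSMul Γ S] (hS : IsHyperbolic δ S) {R : ℝ → ℝ}
    {N : ℝ → ℕ} (hac : AcylindricalWith Γ S R N) {A : Set Γ} (hA : ∀ a ∈ A, a⁻¹ ∈ A)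
    (hfin : ∀ a : Γ, IsOfFinOrder a → a ∈ A) {g : Γ} (hg : IsLoxodromic S g)
    (hach : IsAchiral g) : stableWordNorm A g = 0 := by
  obtain ⟨m, hm, hconj⟩ := hach
  obtain ⟨t, ht⟩ := isConj_iff.1 hconj
  have hgm : IsLoxodromic S (g ^ m) := by
    unfold IsLoxodromic
    rw [translationLength_pow]
    exact mul_pos (by exact_mod_cast hm) hg
  obtain ⟨p, x, hx⟩ := h.exists_isAxisPoint_pow hδ hS hgm
  refine stableWordNorm_eq_zero_of_inverts hA hfin ?_ hm ht
  refine hac.isOfFinOrder_of_inverts (hS.fourPoint hδ) hx ?_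
  rw [← mul_inv_eq_iff_eq_mul, ← conj_pow, ht, inv_pow]

/-- The homogeneous quasimorphism `h_{g^M}` is bounded below at `g`. -/
theorem one_div_le_homogenization {δ K E : ℝ} (hS : IsHyperbolic δ S) (hK : 0 < K) {M : ℕ}
    (hM : 0 < M) {g : Γ} {x : S} {w : ArcPath S} (hj : w.Joins x (g ^ M • x))
    (hw : 2 * (K + 1) ≤ w.len) (hw' : w.len ≤ M * translationLength S g + K)
    (hrev : ∀ n : ℕ, dist x (g ^ n • x) ≤ pathCost Γ w.reverse (K + 1) x (g ^ n • x))
    (hE : ∀ a b : Γ, |epsteinFujiwara w (K + 1) x (a * b) - epsteinFujiwara w (K + 1) x a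
      - epsteinFujiwara w (K + 1) x b| ≤ E) :
    1 / (M : ℝ) ≤ homogenization (epsteinFujiwara w (K + 1) x : Γ → ℝ) g := by
  have hW : 0 < K + 1 := by linarith
  have hcost : pathCost Γ w (K + 1) x (g ^ M • x) ≤ M * translationLength S g - 1 := by
    have h1 := pathCost_le (Γ := Γ) hW hw hj
    have h2 : (1 : ℝ) ≤ copyCount Γ w w := by
      exact_mod_cast one_le_copyCount_self (show 0 < w.len by linarith)
    have h3 := le_mul_of_one_le_right hW.le h2
    linarith
  have hcosts : ∀ n : ℕ, pathCost Γ w (K + 1) x ((g ^ M) ^ n • x)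
      ≤ n * (M * translationLength S g - 1) := by
    intro n
    induction n with
    | zero => simpa using pathCost_le_dist (Γ := Γ) hS hW hw x x
    | succ n ih =>
      have h1 := pathCost_triangle (Γ := Γ) hS hW hw x ((g ^ M) ^ n • x) ((g ^ M) ^ (n + 1) • x)
      rw [pow_succ, mul_smul, pathCost_smul hS hW hw] at h1
      rw [pow_succ, mul_smul]
      push_cast
      linarith
  -- Over n periods the forward cost is at most n(Mτ − 1) and the backward cost at least the
  -- distance, hence at least nMτ.
  have hval : ∀ n : ℕ, (n : ℝ) ≤ epsteinFujiwara w (K + 1) x (g ^ (M * n)) := by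
    intro n
    have h1 := hcosts n
    have h2 := hrev (M * n)
    have h3 := mul_translationLength_le g x (M * n)
    rw [← pow_mul] at h1
    push_cast at h3
    rw [epsteinFujiwara, countingFunction_eq, countingFunction_eq]
    linarith
  refine ge_of_tendsto ((tendsto_homogenization hE g).comp (tendsto_id.const_mul_atTop' hM)) ?_
  filter_upwards [eventually_gt_atTop 0] with n hn
  have hn' : (0 : ℝ) < n := by exact_mod_cast hn
  have hM' : (0 : ℝ) < M := by exact_mod_cast hM
  simp only [Function.comp, id, Nat.cast_mul]
  rw [div_le_div_iff₀ hM' (by positivity)]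
  have := mul_le_mul_of_nonneg_left (hval n) hM'.le
  linarith

end Admissible

end GapThm

end

/-! ### Choice of M and assembly. -/

theorem mainTheorem4 (δ : ℝ) (hδ : 0 < δ) :
    (∃ T K : ℝ, GapThm.DisplacementConstants.{u, v} δ T K) ∧
    ∀ T K : ℝ, GapThm.DisplacementConstants.{u, v} δ T K →
    ∀ (R : ℝ → ℝ) (N : ℝ → ℕ), ∃ M : ℕ, 0 < M ∧
    ∀ (Γ : Type u) [Group Γ] (S : Type v) [MetricSpace S] [Nonempty S] [MulAction Γ S]
      [IsIsometricSMul Γ S],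
      GapThm.IsHyperbolic δ S → GapThm.AcylindricalWith Γ S R N →
      (∀ g : Γ, GapThm.IsLoxodromic S g → ¬ GapThm.IsAchiral g →
        max T (2 * K + 2) ≤ GapThm.translationLength S (g ^ M) ∧
        ∀ (x₀ : S) (w : GapThm.ArcPath S), GapThm.Admissible δ T K M g x₀ w →
          1 / (M : ℝ) ≤
            GapThm.homogenization (GapThm.epsteinFujiwara w (K + 1) x₀ : Γ → ℝ) g) ∧
      ∀ A : Set Γ, (∀ a ∈ A, a⁻¹ ∈ A) → (∀ a : Γ, IsOfFinOrder a → a ∈ A) →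
      ∀ (x₀ : Γ → S) (w : Γ → GapThm.ArcPath S),
        (∀ g : Γ, GapThm.IsLoxodromic S g → ¬ GapThm.IsAchiral g →
          GapThm.Admissible δ T K M g (x₀ g) (w g)) →
      ∀ C : ℝ, 0 < C →
        (∀ g : Γ, GapThm.IsLoxodromic S g → ¬ GapThm.IsAchiral g → ∀ a ∈ A,
          |GapThm.homogenization (GapThm.epsteinFujiwara (w g) (K + 1) (x₀ g) : Γ → ℝ) a| ≤ C) →
        (∀ g : Γ, GapThm.IsLoxodromic S g →
          (GapThm.IsAchiral g ↔ GapThm.stableWordNorm A g = 0)) ∧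
        ∃ Θ : ℝ, 0 < Θ ∧ ∀ g : Γ, GapThm.IsLoxodromic S g → ¬ GapThm.IsAchiral g →
          ENNReal.ofReal Θ ≤ GapThm.stableWordNorm A g := by
  refine ⟨GapThm.exists_displacementConstants hδ, fun T K hTK R N => ?_⟩
  have hK : 0 < K := hTK.2.1
  have hW : 0 < K + 1 := by linarith
  obtain ⟨E, hE0, hE⟩ := GapThm.exists_defect_bound.{u, v} hδ hW
  obtain ⟨r, -, hrev⟩ := GapThm.exists_dist_le_pathCost_reverse.{u, v} (δ := δ) (W := K + 1)
    (B := 2 * K + 2 * (8 * δ)) hδ hW (by positivity)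
  set B := 2 * K + 2 * (8 * δ) with hB
  obtain ⟨q, hq⟩ := exists_nat_ge (max (max T (2 * K + 2)) (R r))
  -- The term N r leaves room for the twisted elements in the reversal argument. As N(B+1)·τ(g) ≥ 1,
  -- the second term gives (M − N r)τ(g) ≥ q, which dominates T, 2K+2 and R r; the last 1 ensures M
  -- > 0.
  obtain ⟨M, hM⟩ : ∃ M, M = N r + N (B + 1) * q + 1 := ⟨_, rfl⟩
  have hM0 : 0 < M := by omega
  refine ⟨M, hM0, fun Γ _ S _ _ _ _ hS hac => ?_⟩
  have hτ : ∀ g : Γ, GapThm.IsLoxodromic S g →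
      (q : ℝ) ≤ ((M : ℝ) - N r) * GapThm.translationLength S g := by
    intro g hg
    obtain ⟨p, x, hx⟩ := hTK.exists_isAxisPoint_pow hδ hS hg
    have h1 := hac.one_le_mul_translationLength (hx.of_pow (hS.fourPoint hδ))
    have h2 := mul_le_mul_of_nonneg_left h1 (Nat.cast_nonneg (α := ℝ) q)
    have h3 : 0 < GapThm.translationLength S g := hg
    rw [hM]
    push_cast
    linarith
  have hlow : ∀ g : Γ, GapThm.IsLoxodromic S g → ¬ GapThm.IsAchiral g →
      ∀ (x₀ : S) (w : GapThm.ArcPath S), GapThm.Admissible δ T K M g x₀ w →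
        1 / (M : ℝ) ≤
          GapThm.homogenization (GapThm.epsteinFujiwara w (K + 1) x₀ : Γ → ℝ) g := by
    intro g hg hch x₀ w hadm
    obtain ⟨hax, hw, hw'⟩ := hadm.isAxisPoint_and_len hδ hTK hS hM0
    refine GapThm.one_div_le_homogenization hS hK hM0 hadm.2.2 hw hw' ?_ (hE Γ S hS w hw x₀)
    exact hrev Γ S R N hS hac g x₀ hax hch M (by rw [hM, add_assoc]; exact Nat.le_add_right _ _)
      ((le_max_right _ _).trans (hq.trans (hτ g hg))) w hadm.2.2 hw
  refine ⟨fun g hg hch => ⟨?_, hlow g hg hch⟩, ?_⟩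
  · have h1 := (le_max_left _ _).trans (hq.trans (hτ g hg))
    have h2 : 0 ≤ (N r : ℝ) * GapThm.translationLength S g :=
      mul_nonneg (Nat.cast_nonneg _) (GapThm.translationLength_nonneg g)
    rw [GapThm.translationLength_pow]
    linarith
  intro A hA hfin x₀ w hadm C hC hAC
  have hM' : (0 : ℝ) < M := by exact_mod_cast hM0
  have hCE : 0 < C + 3 * E := by positivity
  have hgap : ∀ g : Γ, GapThm.IsLoxodromic S g → ¬ GapThm.IsAchiral g →
      -- The value 1/M of h at g is divided by the largest contribution C + 3E of one letter of A;
      -- neither depends on g.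
      ENNReal.ofReal (1 / (M * (C + 3 * E))) ≤ GapThm.stableWordNorm A g := by
    intro g hg hch
    by_cases hex : ∃ m : ℕ, 0 < m ∧ g ^ m ∈ Subgroup.closure A
    · obtain ⟨m, hm, hmA, he⟩ := GapThm.exists_stableWordNorm_eq hex
      rw [he]
      refine ENNReal.ofReal_le_ofReal ?_
      obtain ⟨-, hw, -⟩ := (hadm g hg hch).isAxisPoint_and_len hδ hTK hS hM0
      have hdef := hE Γ S hS (w g) hw (x₀ g)
      have h1 := hlow g hg hch _ _ (hadm g hg hch)
      have h2 := (le_abs_self _).trans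
        (GapThm.abs_homogenization_le_stableWordNormAux hA hdef (hAC g hg hch) hmA)
      rw [GapThm.homogenization_pow hdef g hm] at h2
      have hm' : (0 : ℝ) < m := by exact_mod_cast hm
      have h3 := mul_le_mul_of_nonneg_left h1 hm'.le
      rw [le_div_iff₀ hm', one_div_mul_eq_div, div_le_iff₀ (by positivity)]
      have h4 := mul_le_mul_of_nonneg_left (h3.trans h2) hM'.le
      rw [mul_one_div, mul_div_cancel₀ _ hM'.ne'] at h4
      linarith
    · rw [GapThm.stableWordNorm, dif_neg hex]
      exact le_top
  refine ⟨fun g hg => ⟨fun hach =>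
    GapThm.stableWordNorm_eq_zero_of_isAchiral hδ hTK hS hac hA hfin hg hach, fun h0 => ?_⟩,
    1 / (M * (C + 3 * E)), by positivity, hgap⟩
  by_contra hch
  have h1 := hgap g hg hch
  rw [h0, nonpos_iff_eq_zero, ENNReal.ofReal_eq_zero] at h1
  have h2 : 0 < 1 / (M * (C + 3 * E)) := by positivity
  linarith
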